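/- Write $M^{3\times3}$ for the real $3\times 3$ matrices and $SO(3)=\{R: R^TR=\mathbf 1,\ \det R=1\}$. For $\alpha,\beta,\gamma>0$ let $$U_1=\begin{pmatrix}\beta&0&0\\0&\frac{\alpha+\gamma}2&\frac{\alpha-\gamma}2\\0&\frac{\alpha-\gamma}2&\frac{\alpha+\gamma}2\end{pmatrix},\qquad U_2=\begin{pmatrix}\beta&0&0\\0&\frac{\alpha+\gamma}2&\frac{\gamma-\alpha}2\\0&\frac{\gamma-\alpha}2&\frac{\alpha+\gamma}2\end{pmatrix},$$ and let $U_3,U_4$ (resp. $U_5,U_6$) be the matrices obtained from $U_1,U_2$ by interchanging the first and second (resp. the first and third) coordinate axes; these are the six martensitic variants of the cubic-to-orthorhombic transition of Cu-Al-Ni. For $\delta>0$ let $W(A)=-\delta$ if $A\in SO(3)$, $W(A)=0$ if $A\in\bigcup_{i=1}^6SO(3)U_i$, and $W(A)=+\infty$ otherwise. (For the parameters below these wells are disjoint.) Let $\Omega$ be an open rectangular bar. A family $\nu=(\nu_x)_{x\in\Omega}$ of probability measures on $M^{3\times3}$ is a $W^{1,\infty}$ gradient Young measure if it is generated by the gradients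 of a sequence bounded in $W^{1,\infty}$ sense ($|\nabla z^k|\le M$ a.e. for all $k$). Put $\bar\nu_x=\int A\,d\nu_x(A)$ and $I(\nu)=\int_\Omega\int_{M^{3\times3}}W(A)\,d\nu_x(A)\,dx$. For a corner $v$ of $\Omega$ and $r>0$ let $B_c=\Omega\cap B(v,r)$. The set $\mathcal A_c$ of measures admissible for the corner consists of the $W^{1,\infty}$ gradient Young measures $\nu$ with $\nu_x=\delta_{U_s}$ for $x\in\Omega\setminus B_c$ and $\bar\nu_x=\nabla y(x)$ for a.e. $x\in\Omega$, for some Lipschitz $y:\Omega\to\mathbb R^3$ with $y(x)=U_sx$ on $\partial B_c\cap\Omega$ and $\int_\Omega\det\nabla y\,dx\le\mathrm{vol}(y(\Omega))$. The density $W$ is called quasiconvex at $U_s$ at the corner if $I(\nu)\ge I(\delta_{U_s})$ for all $\nu\in\mathcal A_c$. **Theorem.** Let $\alpha\in[1.061,1.064]$, $\beta\in[0.915,0.918]$, $\gamma\in[1.022,1.024]$ with $\alpha\beta\gamma=\det U_i\le1$; this includes the Cu-Al-Ni values $\alpha=1.06372$, $\beta=0.91542$, $\gamma=1.02368$. Let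 $s\in\{1,\dots,6\}$. Then there are at least two of the eight corners of a bar, and a number $\varepsilon>0$, such that the following holds for each of these corners $v$, for every rectangular bar $\Omega$ (of any dimensions and position) whose orthonormal edge directions lie within distance $\varepsilon$ of the respective principal axes, for every $\delta>0$ and for every $r>0$. There are $\nu\in\mathcal A_c$ with $I(\nu)<I(\delta_{U_s})$, rotations $R,Q\in SO(3)$, an index $l\in\{1,\dots,6\}$, a number $\lambda\in(0,1)$, nonzero vectors $a,b$, non-parallel vectors $m,n$ and constants $c_1,c_2>0$ such that $$QU_l=U_s+a\otimes n,\qquad \lambda U_s+(1-\lambda)QU_l=R+b\otimes m,$$ and for every $x\in\Omega$ $$\nu_x=\begin{cases}\delta_R,& m\cdot(x-v)<c_1,\\ \lambda\delta_{U_s}+(1-\lambda)\delta_{QU_l},& m\cdot(x-v)\ge c_1,\ n\cdot(x-v)<c_2,\\ \delta_{U_s},&\text{otherwise,}\end{cases}$$ where every $x\in\overline\Omega$ with $m\cdot(x-v)\le c_1$ satisfies $n\cdot(x-v)<c_2$. In particular $\nu_x=\delta_R$ in a neighbourhood of the corner, and the laminate separates this region from the pure variant $U_s$. Consequently $W$ is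 not quasiconvex at $U_s$ at these corners. -/

import Mathlib

open MeasureTheory ProbabilityTheory Set Filter Topology
open scoped NNReal ENNReal

noncomputable section

namespace CuAlNi

/-- Points of three-dimensional Euclidean space. -/
abbrev E3 := EuclideanSpace ℝ (Fin 3)

/-- Real `3 × 3` matrices (deformation gradients), with their Borel σ-algebra. -/
abbrev Mat3 := Matrix (Fin 3) (Fin 3) ℝ

instance : MeasurableSpace Mat3 := borel Mat3

instance : BorelSpace Mat3 := ⟨rfl⟩

/-- The rotations. -/
def SO3 : Set Mat3 := {R | R.transpose * R = 1 ∧ R.det = 1}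

/-- The rank-one matrix `a ⊗ n`. -/
def tensor (a n : E3) : Mat3 := Matrix.of fun i j => a i * n j

/-- The linear map `x ↦ U x`. -/
def act (U : Mat3) (x : E3) : E3 := Matrix.toEuclideanLin U x

/-! ### Lattice parameters, variants and energy density -/

/-- A small box of cubic-to-orthorhombic transformation stretches of Cu-Al-Ni, together with the
standing assumption that the determinant of the variants is at most one. It contains the measured
stretches of the specimen, see `specimen_lattice`, and also the other commonly quoted
values `1.0619, 0.9178, 1.0230` for this alloy, see `standard_lattice`. -/
structure IsCuAlNiLattice (α β γ : ℝ) : Prop where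
  alpha_mem : α ∈ Icc (1.061 : ℝ) 1.064
  beta_mem : β ∈ Icc (0.915 : ℝ) 0.918
  gamma_mem : γ ∈ Icc (1.022 : ℝ) 1.024
  det_le_one : α * β * γ ≤ 1

/-- The measured values for the specimen. -/
theorem specimen_lattice : IsCuAlNiLattice 1.06372 0.91542 1.02368 := by
  constructor <;> norm_num

theorem standard_lattice : IsCuAlNiLattice 1.0619 0.9178 1.0230 := by
  constructor <;> norm_num

/-- The six variants `U_1, …, U_6` (indexed from `0`) of orthorhombic martensite. -/
def variant (α β γ : ℝ) : Fin 6 → Mat3 :=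
  ![!![β, 0, 0; 0, (α + γ) / 2, (α - γ) / 2; 0, (α - γ) / 2, (α + γ) / 2],
    !![β, 0, 0; 0, (α + γ) / 2, (γ - α) / 2; 0, (γ - α) / 2, (α + γ) / 2],
    !![(α + γ) / 2, 0, (α - γ) / 2; 0, β, 0; (α - γ) / 2, 0, (α + γ) / 2],
    !![(α + γ) / 2, 0, (γ - α) / 2; 0, β, 0; (γ - α) / 2, 0, (α + γ) / 2],
    !![(α + γ) / 2, (α - γ) / 2, 0; (α - γ) / 2, (α + γ) / 2, 0; 0, 0, β],
    !![(α + γ) / 2, (γ - α) / 2, 0; (γ - α) / 2, (α + γ) / 2, 0; 0, 0, β]]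

open Classical in
/-- The energy density `W`: equal to `-δ` on austenite, to `0` on martensite and to `+∞` off the
energy wells. -/
def energyDensity (α β γ δ : ℝ) (A : Mat3) : EReal :=
  if A ∈ SO3 then ((-δ : ℝ) : EReal)
  else if ∃ i : Fin 6, ∃ Q ∈ SO3, A = Q * variant α β γ i then 0
  else ⊤

/-- The integral of an extended real valued function: integral of the positive part minus integral
of the negative part (used for functions bounded below on finite measure spaces). -/
def extIntegral {X : Type*} [MeasurableSpace X] (μ : Measure X) (f : X → EReal) : EReal :=
  ((∫⁻ x, (f x).toENNReal ∂μ : ℝ≥0∞) : EReal) - ((∫⁻ x, (-(f x)).toENNReal ∂μ : ℝ≥0∞) : EReal)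

/-- The total energy `I(ν) = ∫_Ω ⟨ν_x, W⟩ dx`. -/
def energy (α β γ δ : ℝ) (Ω : Set E3) (ν : Kernel E3 Mat3) : EReal :=
  extIntegral (volume.restrict Ω) fun x => extIntegral (ν x) (energyDensity α β γ δ)

/-! ### Gradient Young measures -/

/-- The Jacobian matrix of `y` at `x`; for a map that is Lipschitz on an open set it exists at almost
every point of that set and agrees with the weak gradient. -/
def grad (y : E3 → E3) (x : E3) : Mat3 :=
  Matrix.of fun i j => fderiv ℝ y x (EuclideanSpace.single j 1) i

/-- The centre of mass of a measure on matrices. -/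
def barycenter (μ : Measure Mat3) : Mat3 := Matrix.of fun i j => ∫ A, A i j ∂μ

/-- The `x`-independent Young measure `δ_U`. -/
def pureKernel (U : Mat3) : Kernel E3 Mat3 := Kernel.const E3 (Measure.dirac U)

/-- `(ν_x)`, `x ∈ Ω`, is a `W^{1,∞}` gradient Young measure: a measurable family of probability
measures generated by the gradients of a sequence `z k` of maps. Here `Ω` is an open bounded convex
set, so that the uniform bound on the gradients is a uniform Lipschitz bound. The family is extended
to all of space in an arbitrary way; only its values in `Ω` matter. -/
structure IsGradientYoungMeasure (Ω : Set E3) (ν : Kernel E3 Mat3) : Prop where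
  isMarkov : IsMarkovKernel ν
  generated : ∃ (z : ℕ → E3 → E3) (M : ℝ≥0), (∀ k, LipschitzOnWith M (z k) Ω) ∧
    ∀ f : Mat3 → ℝ, Continuous f → HasCompactSupport f →
    ∀ g : E3 → ℝ, IntegrableOn g Ω volume →
      Tendsto (fun k => ∫ x in Ω, g x * f (grad (z k) x)) atTop
        (𝓝 (∫ x in Ω, g x * ∫ A, f A ∂(ν x)))

/-- Admissibility of `ν` as a variation of `δ_U` localized in the subset `B` of `Ω`: `ν` is a
gradient Young measure with `ν_x = δ_U` outside `B`, whose underlying deformation `y` equals `U x` on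
the part of the boundary of `B` inside `Ω` and satisfies the Ciarlet-Nečas condition. -/
structure IsAdmissible (U : Mat3) (Ω B : Set E3) (ν : Kernel E3 Mat3) : Prop where
  gym : IsGradientYoungMeasure Ω ν
  eq_outside : ∀ x ∈ Ω \ B, ν x = Measure.dirac U
  underlying : ∃ (y : E3 → E3) (M : ℝ≥0), LipschitzOnWith M y Ω ∧
    (∀ᵐ x ∂(volume.restrict Ω), barycenter (ν x) = grad y x) ∧
    (∀ x ∈ frontier B ∩ Ω, y x = act U x) ∧
    ENNReal.ofReal (∫ x in Ω, (grad y x).det) ≤ volume (y '' Ω)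

/-! ### Bars and their corners -/

/-- A rectangular bar: one vertex, an orthonormal frame of edge directions, and edge lengths. -/
structure Bar where
  vertex : E3
  frame : OrthonormalBasis (Fin 3) ℝ E3
  len : Fin 3 → ℝ
  len_pos : ∀ i, 0 < len i

/-- The open region occupied by a bar. -/
def Bar.region (P : Bar) : Set E3 :=
  {x | ∀ i, inner ℝ (P.frame i) (x - P.vertex) ∈ Ioo 0 (P.len i)}

/-- The eight corners of a bar: for each edge direction `i`, `c i` says at which end of that edge
the corner lies. -/
def Bar.corner (P : Bar) (c : Fin 3 → Bool) : E3 :=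
  P.vertex + ∑ i, (if c i then P.len i else 0) • P.frame i

/-- The edges of the bar are directed along the principal axes up to an error less than `ε`. -/
def Bar.AlignedWithin (P : Bar) (ε : ℝ) : Prop :=
  ∀ i, ‖P.frame i - EuclideanSpace.single i 1‖ < ε

/-- The set of measures admissible for a corner: `B` is the intersection of the bar with the ball of
radius `r` around the corner. -/
def cornerAdmissible (U : Mat3) (P : Bar) (c : Fin 3 → Bool) (r : ℝ) : Set (Kernel E3 Mat3) :=
  {ν | IsAdmissible U P.region (P.region ∩ Metric.ball (P.corner c) r) ν}

/-- Quasiconvexity of `W` at `U` at a corner: no measure admissible for the corner has lower energy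
than `δ_U`. -/
def QuasiconvexAtCorner (α β γ δ : ℝ) (U : Mat3) (P : Bar) (c : Fin 3 → Bool) (r : ℝ) : Prop :=
  ∀ ν ∈ cornerAdmissible U P c r,
    energy α β γ δ P.region (pureKernel U) ≤ energy α β γ δ P.region ν

/-- `ν` is an austenite nucleus at the corner `v` of `Ω`. With `F` the stabilized variant and `G` a
rotated variant,
* `F` and `G = F + a ⊗ n` are rank-one connected, as are the average `λ F + (1 - λ) G` of their simple
  laminate and the rotation `R`, with `a ⊗ n` and `b ⊗ m` nonzero and `m`, `n` not parallel;
* `ν_x = δ_R` in a neighbourhood of `v`, more precisely on the corner side of a plane with normal `m`; beyond it `ν_x` is the laminate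
  `λ δ_F + (1 - λ) δ_G` up to a plane with normal `n`, and `ν_x = δ_F` beyond that plane;
* the austenite region does not touch the region of pure `F`. -/
def IsCornerNucleus (α β γ : ℝ) (s : Fin 6) (Ω : Set E3) (v : E3) (ν : Kernel E3 Mat3) : Prop :=
  ∃ R ∈ SO3, ∃ Q ∈ SO3, ∃ l : Fin 6, ∃ lam ∈ Ioo (0 : ℝ) 1, ∃ a n b m : E3, ∃ c₁ c₂ : ℝ,
    a ≠ 0 ∧ b ≠ 0 ∧ LinearIndependent ℝ ![m, n] ∧ 0 < c₁ ∧ 0 < c₂ ∧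
    Q * variant α β γ l = variant α β γ s + tensor a n ∧
    lam • variant α β γ s + (1 - lam) • (Q * variant α β γ l) = R + tensor b m ∧
    (∃ ρ : ℝ, 0 < ρ ∧ ∀ x ∈ Ω ∩ Metric.ball v ρ, ν x = Measure.dirac R) ∧
    (∀ x ∈ closure Ω, inner ℝ m (x - v) ≤ c₁ → inner ℝ n (x - v) < c₂) ∧
    ∀ x ∈ Ω, ν x =
      if inner ℝ m (x - v) < c₁ then Measure.dirac R
      else if inner ℝ n (x - v) < c₂ then
        ENNReal.ofReal lam • Measure.dirac (variant α β γ s) +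
          ENNReal.ofReal (1 - lam) • Measure.dirac (Q * variant α β γ l)
      else Measure.dirac (variant α β γ s)

end CuAlNi

end

noncomputable section

namespace CuAlNi

/-! ### Rank-one connections -/

/-! The proof solves the twinning and habit plane equations explicitly for one variant `U`, with a
single sign pattern for both normals, and lets the geometry of a corner do the rest.

Algebra. For the axis `e = (1,1,0)`, the type II twin of `U = U_1` and `U_4` has `a = U e` and `n =
e - c U² e`, where `c = 2/|U e|²`. Put `G = U + μ a ⊗ n`. The equation `det (Gᵀ G - 1) = 0` is
quadratic in `μ`, and its larger root lies in `[0.6, 0.8]`. At this root `Gᵀ G - 1` is indefinite of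
rank two, hence of the form `m ⊗ d + d ⊗ m`, and this makes `G` rank-one connected to a rotation `R`
with normal `m` (`exists_rotation_of_gram`). Interval estimates show that `m` and `n` both have
signs `(+,-,-)`. Signed permutations carry the solution to the other variants
(`IsNucleusData.conj`).

Geometry. Since `m_i n_i > 0`, at the corner whose inward edges have the signs of `m` both normals
make acute angles with all three edges, also for slightly tilted bars. Each of the two planes then
cuts off a small neighbourhood of the corner, and taking `c₁` small against `c₂` keeps austenite
away from pure `U` (`Bar.exists_cuts`). Changing the signs of `a, n, b, m` leaves both equations
intact and gives the opposite corner.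

Analysis. A sawtooth of vanishing period in the direction `n`, truncated near the habit plane,
generates the laminate; the weak limit is a Riemann–Lebesgue statement
(`tendsto_integral_mul_periodic`). The underlying deformation is `U x` plus a Lipschitz perturbation
too small to destroy injectivity, so the area formula yields the Ciarlet–Nečas condition. The energy
is negative because only austenite contributes. -/

open Matrix in
/-- If `GᵀG - 1 = m ⊗ d + d ⊗ m` with `|m| = 1`, then `G` is rank-one connected to a rotation, with
normal `m`. -/
theorem exists_rotation_of_gram (G : Mat3) (m d : Fin 3 → ℝ) (hm : m ⬝ᵥ m = 1)
    (hG : Gᵀ * G = 1 + vecMulVec m d + vecMulVec d m) :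
    ∃ b : Fin 3 → ℝ, G - vecMulVec b m ∈ SO3 ∧ b ⬝ᵥ b = 2 + 2 * (d ⬝ᵥ m) - 2 * G.det := by
  -- A rotation `R = G - b ⊗ m` agrees with `G` on the plane `m^⊥`, so `R m = cof R m = cof G m =
  -- K`. This forces `b = G m - K`. Moreover `|K| = 1`, since `Gᵀ G` induces the standard metric on
  -- that plane.
  set K : Fin 3 → ℝ := (adjugate G)ᵀ *ᵥ m with hK
  have hKK : K ⬝ᵥ K = 1 := by
    have h1 : K ⬝ᵥ K = m ⬝ᵥ ((adjugate (Gᵀ * G)) *ᵥ m) := by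
      rw [adjugate_mul_distrib, ← mulVec_mulVec, ← adjugate_transpose, hK,
        dotProduct_mulVec m, ← mulVec_transpose]
    rw [h1, hG, adjugate_fin_three, ← hm]
    simp [dotProduct, Fin.sum_univ_three, mulVec, vecMulVec_apply]
    ring
  have hGK : Gᵀ *ᵥ K = G.det • m := by
    rw [hK, mulVec_mulVec, ← transpose_mul, adjugate_mul]; simp [smul_mulVec]
  have hGm : Gᵀ *ᵥ (G *ᵥ m) = (1 + d ⬝ᵥ m) • m + d := by
    rw [mulVec_mulVec, hG]
    ext i
    simp only [dotProduct, Fin.sum_univ_three, mulVec, vecMulVec_apply, Matrix.add_apply, Pi.add_apply, Pi.smul_apply, smul_eq_mul] at hm ⊢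
    have h1 : ∑ j, (1 : Mat3) i j * m j = m i := by simp [Matrix.one_apply]
    simp only [Fin.sum_univ_three] at h1
    linear_combination h1 + d i * hm
  have e1 : (G *ᵥ m) ⬝ᵥ (G *ᵥ m) = 1 + 2 * (d ⬝ᵥ m) := by
    rw [dotProduct_mulVec, ← mulVec_transpose, hGm]
    simp [hm]; ring
  have e2 : (G *ᵥ m) ⬝ᵥ K = G.det := by
    rw [dotProduct_comm, dotProduct_mulVec, ← mulVec_transpose, hGK]; simp [hm]
  obtain ⟨b, hb⟩ : ∃ b, b = G *ᵥ m - K := ⟨_, rfl⟩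
  have hbb : b ⬝ᵥ b = 2 + 2 * (d ⬝ᵥ m) - 2 * G.det := by
    rw [hb, sub_dotProduct, dotProduct_sub, dotProduct_sub, e1, e2, hKK, dotProduct_comm K, e2]
    ring
  have hGb : Gᵀ *ᵥ b = (1 + d ⬝ᵥ m - G.det) • m + d := by
    rw [hb, mulVec_sub, hGm, hGK]; module
  refine ⟨b, ⟨?_, ?_⟩, hbb⟩
  · have : (G - vecMulVec b m)ᵀ * (G - vecMulVec b m) =
        Gᵀ * G - vecMulVec (Gᵀ *ᵥ b) m - vecMulVec m (Gᵀ *ᵥ b) + (b ⬝ᵥ b) • vecMulVec m m := by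
      rw [transpose_sub, transpose_vecMulVec, sub_mul, mul_sub, mul_sub, mul_vecMulVec,
        vecMulVec_mul, vecMulVec_mul_vecMulVec, mulVec_transpose, vecMulVec_smul]
      abel
    rw [this, hGb, hbb, hG]
    simp only [add_vecMulVec, smul_vecMulVec, vecMulVec_add, vecMulVec_smul]
    module
  · have h : (G - vecMulVec b m).det = G.det - b ⬝ᵥ K := by
      rw [hK, adjugate_fin_three, det_fin_three, det_fin_three]
      simp [dotProduct, Fin.sum_univ_three, mulVec, vecMulVec_apply]
      ring
    rw [h, hb, sub_dotProduct, e2, hKK]; ring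

/-- A symmetric `3 × 3` matrix with vanishing determinant and a suitable sign pattern is the
symmetrized product of two vectors, one of which has known signs. -/
theorem exists_symm_tensor_of_det_eq_zero {e₁₁ e₁₂ e₁₃ e₂₂ e₂₃ e₃₃ : ℝ}
    (hdet : e₁₁ * (e₂₂ * e₃₃ - e₂₃ ^ 2) - e₁₂ * (e₁₂ * e₃₃ - e₂₃ * e₁₃)
      + e₁₃ * (e₁₂ * e₂₃ - e₂₂ * e₁₃) = 0)
    (h₁₁ : 0 < e₁₁) (h₂₂ : e₂₂ < 0) (h₃₃ : 0 < e₃₃) (h₁₃ : e₁₃ < 0) :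
    ∃ m₁ m₂ m₃ d₁ d₂ d₃ : ℝ, 0 < m₁ ∧ m₂ < 0 ∧ m₃ < 0 ∧
      (m₂ = -m₁ → e₁₁ + 2 * e₁₂ + e₂₂ = 0) ∧
      e₁₁ = 2 * m₁ * d₁ ∧ e₂₂ = 2 * m₂ * d₂ ∧ e₃₃ = 2 * m₃ * d₃ ∧
      e₁₂ = m₁ * d₂ + m₂ * d₁ ∧ e₁₃ = m₁ * d₃ + m₃ * d₁ ∧ e₂₃ = m₂ * d₃ + m₃ * d₂ := by
  have hpos : 0 < e₁₂ ^ 2 - e₁₁ * e₂₂ := by nlinarith [mul_pos h₁₁ (neg_pos.2 h₂₂), sq_nonneg e₁₂]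
  -- Completing the square, `e₁₁` times the quadratic form is `(e₁₁x₁ + e₁₂x₂ + e₁₃x₃)² - (k x₂ - l
  -- x₃)²`; the `x₃²` coefficient is right because the determinant vanishes. The two linear factors
  -- of this difference of squares are `m` and, up to the factor `2 e₁₁`, `d`.
  obtain ⟨k, hk, hk2⟩ : ∃ k : ℝ, 0 < k ∧ k ^ 2 = e₁₂ ^ 2 - e₁₁ * e₂₂ :=
    ⟨√_, Real.sqrt_pos.2 hpos, Real.sq_sqrt hpos.le⟩
  obtain ⟨l, hl⟩ : ∃ l : ℝ, k * l = e₁₁ * e₂₃ - e₁₂ * e₁₃ := ⟨_ / k, mul_div_cancel₀ _ hk.ne'⟩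
  have hl2 : l ^ 2 = e₁₃ ^ 2 - e₁₁ * e₃₃ := by
    have : k ^ 2 * (l ^ 2 - (e₁₃ ^ 2 - e₁₁ * e₃₃)) = 0 := by
      linear_combination (k * l + (e₁₁ * e₂₃ - e₁₂ * e₁₃)) * hl - (e₁₃ ^ 2 - e₁₁ * e₃₃) * hk2
        - e₁₁ * hdet
    rcases mul_eq_zero.1 this with h | h
    · exact absurd h (by positivity)
    · linarith
  have hke : e₁₂ < k := by
    have := mul_pos h₁₁ (neg_pos.2 h₂₂)
    exact lt_of_pow_lt_pow_left₀ 2 hk.le (by nlinarith)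
  have hle : l < -e₁₃ := by
    have := mul_pos h₁₁ h₃₃
    exact lt_of_pow_lt_pow_left₀ 2 (by linarith) (by nlinarith)
  refine ⟨e₁₁, e₁₂ - k, e₁₃ + l, 1 / 2, (e₁₂ + k) / (2 * e₁₁), (e₁₃ - l) / (2 * e₁₁), h₁₁,
    by linarith, by linarith, fun h => ?_, by ring, ?_, ?_, ?_, ?_, ?_⟩
  -- If `m` annihilates `(1,1,0)`, then so does the quadratic form. This is what later excludes `m`
  -- parallel to `n`.
  · have : e₁₁ * (e₁₁ + 2 * e₁₂ + e₂₂) = 0 := by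
      linear_combination (e₁₁ + e₁₂ + k) * h + hk2
    exact (mul_eq_zero.1 this).resolve_left h₁₁.ne'
  · field_simp; linear_combination hk2
  · field_simp; linear_combination hl2
  · field_simp; ring
  · field_simp; ring
  · field_simp; linear_combination -2 * hl

/-! ### The volume fraction and the sign pattern of the strain -/

/-- The habit plane condition will read `c μ (1 - μ) = g`, with `u, w, B` the squares of `α, γ, β`.
The bounds `0.16 = 0.8 · 0.2` and `0.24 = 0.6 · 0.4` place the larger root in `[0.6, 0.8]`. -/
theorem volume_fraction_bounds {u w B : ℝ} (hu : u ∈ Set.Icc (1.1257 : ℝ) 1.1321)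
    (hw : w ∈ Set.Icc (1.0444 : ℝ) 1.0486) (hB : B ∈ Set.Icc (0.8372 : ℝ) 0.8428) {c g : ℝ}
    (hc : c = 2 * B * ((u + w) / 2 - B) * (u - 1) * (w - 1) + (1 - B) *
      ((u + w) * ((u + w) / 2 - B) * ((u + w) / 2 - 1) - (u - w) ^ 2 / 2 * ((u + w) / 2 - B + 2)))
    (hg : g = (1 - B) * (u - 1) * (w - 1) * ((u + w) / 2 + B)) :
    0 < g ∧ 0.16 * c < g ∧ g < 0.24 * c := by
  obtain ⟨hu1, hu2⟩ := hu
  obtain ⟨hw1, hw2⟩ := hw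
  obtain ⟨hB1, hB2⟩ := hB
  refine ⟨?_, ?_⟩
  · rw [hg]
    refine mul_pos (mul_pos (mul_pos ?_ ?_) ?_) ?_ <;> linarith
  -- Expanding about the lower corner of the box makes all monomials nonnegative and tiny, so
  -- bounding each one separately reduces the claim to linear arithmetic.
  obtain ⟨p, rfl⟩ : ∃ p, u = 1.1257 + p := ⟨u - 1.1257, by ring⟩
  obtain ⟨q, rfl⟩ : ∃ q, w = 1.0444 + q := ⟨w - 1.0444, by ring⟩
  obtain ⟨r, rfl⟩ : ∃ r, B = 0.8372 + r := ⟨B - 0.8372, by ring⟩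
  have hp : 0 ≤ p := by linarith
  have hq : 0 ≤ q := by linarith
  have hr : 0 ≤ r := by linarith
  have hp' : p ≤ 0.0064 := by linarith
  have hq' : q ≤ 0.0042 := by linarith
  have hr' : r ≤ 0.0056 := by linarith
  have key : ∀ x y b c : ℝ, 0 ≤ x ∧ x ≤ b → 0 ≤ y ∧ y ≤ c → 0 ≤ x * y ∧ x * y ≤ b * c :=
    fun x y b c hx hy => ⟨mul_nonneg hx.1 hy.1, mul_le_mul hx.2 hy.2 hy.1 (hx.1.trans hx.2)⟩
  have p1 := And.intro hp hp'
  have q1 := And.intro hq hq'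
  have r1 := And.intro hr hr'
  have pp := key _ _ _ _ p1 p1
  have pq := key _ _ _ _ p1 q1
  have pr := key _ _ _ _ p1 r1
  have qq := key _ _ _ _ q1 q1
  have qr := key _ _ _ _ q1 r1
  have rr := key _ _ _ _ r1 r1
  have ppq := key _ _ _ _ pp q1
  have ppr := key _ _ _ _ pp r1
  have pqq := key _ _ _ _ pq q1
  have pqr := key _ _ _ _ pq r1
  have prr := key _ _ _ _ pr r1
  have qqr := key _ _ _ _ qq r1
  have qrr := key _ _ _ _ qr r1
  have ppqr := key _ _ _ _ ppq r1
  have pqqr := key _ _ _ _ pqq r1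
  have pqrr := key _ _ _ _ pqr r1
  norm_num at pp pq pr qq qr rr ppq ppr pqq pqr prr qqr qrr ppqr pqqr pqrr
  subst hc hg
  constructor
  · ring_nf at *
    linarith
  · ring_nf at *
    linarith

theorem mul_mem_bounds {x y a b c d : ℝ} (ha : 0 ≤ a) (hax : a ≤ x) (hxb : x ≤ b) (hc : 0 ≤ c)
    (hcy : c ≤ y) (hyd : y ≤ d) : a * c ≤ x * y ∧ x * y ≤ b * d :=
  ⟨mul_le_mul hax hcy hc (ha.trans hax),
    mul_le_mul hxb hyd (hc.trans hcy) ((ha.trans hax).trans hxb)⟩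

theorem gram_entries_signs {u w B μ e₁₁ e₁₂ e₁₃ e₂₂ e₂₃ e₃₃ : ℝ} (hu : u ∈ Set.Icc (1.1257 : ℝ) 1.1321)
    (hw : w ∈ Set.Icc (1.0444 : ℝ) 1.0486) (hB : B ∈ Set.Icc (0.8372 : ℝ) 0.8428)
    (hμ : μ ∈ Set.Icc (0.6 : ℝ) 0.8) (ht : μ * (1 - μ) ∈ Set.Icc (0.16 : ℝ) 0.24)
    {A D t : ℝ} (hA : A = (u + w) / 2) (hD : D = (u - w) / 2) (hT : t = μ * (1 - μ) / (A + B))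
    (h₂₂ : e₂₂ = A - 1 - μ * (A - B) - t * (A - B) ^ 2)
    (h₃₃ : e₃₃ = A - 1 - 4 * t * D ^ 2)
    (h₁₂ : e₁₂ = t * (A - B) ^ 2)
    (h₁₃ : e₁₃ = -(μ * D) + 2 * t * (A - B) * D)
    (h₂₃ : e₂₃ = D - μ * D - 2 * t * (A - B) * D)
    (hdet : e₁₁ * (e₂₂ * e₃₃ - e₂₃ ^ 2) - e₁₂ * (e₁₂ * e₃₃ - e₂₃ * e₁₃)
      + e₁₃ * (e₁₂ * e₂₃ - e₂₂ * e₁₃) = 0) :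
    0 < e₁₁ ∧ e₂₂ < 0 ∧ 0 < e₃₃ ∧ e₁₃ < 0 := by
  obtain ⟨hu1, hu2⟩ := hu
  obtain ⟨hw1, hw2⟩ := hw
  obtain ⟨hB1, hB2⟩ := hB
  obtain ⟨hm1, hm2⟩ := hμ
  obtain ⟨ht1, ht2⟩ := ht
  have hA1 : 1.085 ≤ A := by linarith
  have hA2 : A ≤ 1.0904 := by linarith
  have hD1 : 0.0385 ≤ D := by linarith
  have hD2 : D ≤ 0.0439 := by linarith
  obtain ⟨F, hF⟩ : ∃ F, A - B = F := ⟨_, rfl⟩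
  have hF1 : 0.2422 ≤ F := by linarith
  have hF2 : F ≤ 0.2532 := by linarith
  have htu : t ≤ 0.125 := by rw [hT, div_le_iff₀] <;> linarith
  have htl : 0.08 ≤ t := by rw [hT, le_div_iff₀] <;> linarith
  rw [hF] at h₂₂ h₁₂ h₁₃ h₂₃
  clear hT hF hA hD
  have hFF := mul_mem_bounds (by norm_num) hF1 hF2 (by norm_num) hF1 hF2
  have hDD := mul_mem_bounds (by norm_num) hD1 hD2 (by norm_num) hD1 hD2
  have hμF := mul_mem_bounds (by norm_num) hm1 hm2 (by norm_num) hF1 hF2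
  have htF := mul_mem_bounds (by norm_num) htl htu (by norm_num) hF1 hF2
  have htFF := mul_mem_bounds (by norm_num) htl htu (by norm_num) hFF.1 hFF.2
  have htDD := mul_mem_bounds (by norm_num) htl htu (by norm_num) hDD.1 hDD.2
  have k₁₂ : 0 ≤ e₁₂ ∧ e₁₂ ≤ 0.00803 := by
    rw [h₁₂, pow_two]; norm_num at htFF; constructor <;> linarith
  have k₃₃ : 0 < e₃₃ ∧ e₃₃ ≤ 0.0904 := by
    rw [h₃₃, pow_two]; norm_num at htDD; constructor <;> linarith
  have k₂₂ : 0.059 ≤ -e₂₂ ∧ -e₂₂ ≤ 1 := by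
    rw [h₂₂, pow_two]; norm_num at htFF hμF; constructor <;> linarith
  norm_num at htF
  have k₁₃ : 0.0206 ≤ -e₁₃ ∧ -e₁₃ ≤ 0.0352 := by
    have := mul_mem_bounds (x := μ - 2 * (t * F)) (a := 0.536) (b := 0.8) (by norm_num)
      (by linarith) (by linarith) (by norm_num) hD1 hD2
    norm_num at this
    constructor <;> linarith
  have k₂₃ : 0 ≤ e₂₃ ∧ e₂₃ ≤ 0.0176 := by
    have := mul_mem_bounds (x := 1 - μ - 2 * (t * F)) (a := 0.1) (b := 0.4) (by norm_num)
      (by linarith) (by linarith) (by norm_num) hD1 hD2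
    norm_num at this
    constructor <;> linarith
  refine ⟨?_, by linarith, k₃₃.1, by linarith⟩
  clear h₂₂ h₃₃ h₁₂ h₁₃ h₂₃ hFF hDD hμF htF htFF htDD
  have b₁ := mul_mem_bounds (by norm_num) k₁₃.1 k₁₃.2 (by norm_num) k₁₃.1 k₁₃.2
  have b₂ := mul_mem_bounds (by norm_num) k₂₂.1 k₂₂.2 (by norm_num) b₁.1 b₁.2
  have b₃ := mul_mem_bounds (by norm_num) k₁₂.1 k₁₂.2 (by norm_num) k₁₂.1 k₁₂.2
  have b₄ := mul_mem_bounds (by norm_num) k₃₃.1.le k₃₃.2 (by norm_num) b₃.1 b₃.2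
  have b₅ := mul_mem_bounds (by norm_num) k₁₂.1 k₁₂.2 (by norm_num) k₂₃.1 k₂₃.2
  have b₆ := mul_mem_bounds (by norm_num) b₅.1 b₅.2 (by norm_num) k₁₃.1 k₁₃.2
  have b₇ : 0 < -e₂₂ * e₃₃ + e₂₃ ^ 2 := by
    have := mul_pos (by linarith : 0 < -e₂₂) k₃₃.1
    positivity
  -- Solving the vanishing determinant for `e₁₁` gives `e₁₁ (-e₂₂e₃₃ + e₂₃²) = -e₂₂e₁₃² - e₁₂²e₃₃ +
  -- 2e₁₂e₁₃e₂₃`, whose first term dominates. Estimating the formula for `e₁₁` over the same ranges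
  -- would be too crude, as it nearly cancels.
  refine pos_of_mul_pos_left (b := -e₂₂ * e₃₃ + e₂₃ ^ 2) ?_ b₇.le
  norm_num at b₂ b₄ b₆
  linarith

/-! ### Nucleus data for the variants -/

/-- Solutions of the twinning equation and of the habit plane equation for the variant `s`, such
that the twin normal `n` and the habit plane normal `m` have the same sign pattern, and such that
the rank-one corrections are small compared with the variant. -/
structure IsNucleusData (α β γ : ℝ) (s : Fin 6) (R Q : Mat3) (l : Fin 6) (lam : ℝ)
    (a n b m : E3) : Prop where
  R_mem : R ∈ SO3
  Q_mem : Q ∈ SO3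
  lam_mem : lam ∈ Ioo (0 : ℝ) 1
  a_ne : a ≠ 0
  b_ne : b ≠ 0
  indep : LinearIndependent ℝ ![m, n]
  twin : Q * variant α β γ l = variant α β γ s + tensor a n
  habit : lam • variant α β γ s + (1 - lam) • (Q * variant α β γ l) = R + tensor b m
  sign : ∀ i, 0 < m i * n i
  small : (1 - lam) * (‖a‖ * ‖n‖) + ‖b‖ * ‖m‖ < 9 / 10
  bound : ∀ x, 9 / 10 * ‖x‖ ≤ ‖act (variant α β γ s) x‖

theorem IsCuAlNiLattice.exists_volume_fraction {α β γ : ℝ} (h : IsCuAlNiLattice α β γ)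
    {A B D : ℝ} (hA : A = (α ^ 2 + γ ^ 2) / 2) (hB : B = β ^ 2) (hD : D = (α ^ 2 - γ ^ 2) / 2) :
    ∃ μ t e₁₁ e₁₂ e₁₃ e₂₂ e₂₃ e₃₃ : ℝ, 0.6 ≤ μ ∧ μ ≤ 0.8 ∧ t = μ * (1 - μ) / (A + B) ∧
      e₁₁ = B - 1 + μ * (A - B) - t * (A - B) ^ 2 ∧
      e₂₂ = A - 1 - μ * (A - B) - t * (A - B) ^ 2 ∧
      e₃₃ = A - 1 - 4 * t * D ^ 2 ∧
      e₁₂ = t * (A - B) ^ 2 ∧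
      e₁₃ = -(μ * D) + 2 * t * (A - B) * D ∧
      e₂₃ = D - μ * D - 2 * t * (A - B) * D ∧
      e₁₁ * (e₂₂ * e₃₃ - e₂₃ ^ 2) - e₁₂ * (e₁₂ * e₃₃ - e₂₃ * e₁₃)
        + e₁₃ * (e₁₂ * e₂₃ - e₂₂ * e₁₃) = 0 ∧
      0 < e₁₁ ∧ e₂₂ < 0 ∧ 0 < e₃₃ ∧ e₁₃ < 0 := by
  obtain ⟨hα1, hα2⟩ := h.alpha_mem
  obtain ⟨hβ1, hβ2⟩ := h.beta_mem
  obtain ⟨hγ1, hγ2⟩ := h.gamma_mem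
  have hu : α ^ 2 ∈ Icc (1.1257 : ℝ) 1.1321 := by constructor <;> nlinarith
  have hw : γ ^ 2 ∈ Icc (1.0444 : ℝ) 1.0486 := by constructor <;> nlinarith
  have hB' : B ∈ Icc (0.8372 : ℝ) 0.8428 := by constructor <;> nlinarith
  obtain ⟨hg, h1, h2⟩ := volume_fraction_bounds hu hw hB' rfl rfl
  generalize hc : 2 * B * ((α ^ 2 + γ ^ 2) / 2 - B) * (α ^ 2 - 1) * (γ ^ 2 - 1) + (1 - B) *
      ((α ^ 2 + γ ^ 2) * ((α ^ 2 + γ ^ 2) / 2 - B) * ((α ^ 2 + γ ^ 2) / 2 - 1) -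
        (α ^ 2 - γ ^ 2) ^ 2 / 2 * ((α ^ 2 + γ ^ 2) / 2 - B + 2)) = c at h1 h2
  generalize hg' : (1 - B) * (α ^ 2 - 1) * (γ ^ 2 - 1) * ((α ^ 2 + γ ^ 2) / 2 + B) = g at hg h1 h2
  have hc0 : 0 < c := by linarith
  have hr1 : g / c < 0.24 := by rw [div_lt_iff₀ hc0]; exact h2
  have hr2 : 0.16 < g / c := by rw [lt_div_iff₀ hc0]; exact h1
  -- `r` is the square root of the discriminant, and `μ = (1 + r)/2` is the larger root.
  obtain ⟨r, hr0, hr⟩ : ∃ r : ℝ, 0 ≤ r ∧ r ^ 2 = 1 - 4 * (g / c) :=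
    ⟨√_, Real.sqrt_nonneg _, Real.sq_sqrt (by linarith)⟩
  have hrl : 0.2 ≤ r := by nlinarith
  have hru : r ≤ 0.6 := by nlinarith
  have hμ : (1 + r) / 2 * (1 - (1 + r) / 2) = g / c := by linear_combination -1 / 4 * hr
  have hSpos : 0 < A + B := by linarith [hu.1, hw.1, hB'.1]
  obtain ⟨μ, hμr⟩ : ∃ μ, μ = (1 + r) / 2 := ⟨_, rfl⟩
  rw [← hμr] at hμ
  obtain ⟨t, ht⟩ : ∃ t, t = μ * (1 - μ) / (A + B) := ⟨_, rfl⟩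
  have key : c * (μ * (1 - μ)) = g := by rw [hμ]; field_simp
  -- With denominators cleared, this determinant is a multiple of the relation `c t = (1 - B)(α² -
  -- 1)(γ² - 1)`.
  have hdet : (B - 1 + μ * (A - B) - t * (A - B) ^ 2) * ((A - 1 - μ * (A - B) - t * (A - B) ^ 2) *
      (A - 1 - 4 * t * D ^ 2) - (D - μ * D - 2 * t * (A - B) * D) ^ 2) - (t * (A - B) ^ 2) *
      ((t * (A - B) ^ 2) * (A - 1 - 4 * t * D ^ 2) - (D - μ * D - 2 * t * (A - B) * D) *
        (-(μ * D) + 2 * t * (A - B) * D))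
      + (-(μ * D) + 2 * t * (A - B) * D) * ((t * (A - B) ^ 2) * (D - μ * D - 2 * t * (A - B) * D)
        - (A - 1 - μ * (A - B) - t * (A - B) ^ 2) * (-(μ * D) + 2 * t * (A - B) * D)) = 0 := by
    have : c * t = g / (A + B) := by rw [ht, ← key]; ring
    have e : g / (A + B) = (1 - B) * (α ^ 2 - 1) * (γ ^ 2 - 1) := by
      rw [div_eq_iff hSpos.ne', ← hg', hA]
    rw [e, ← hc] at this
    have hα : α ^ 2 = A + D := by linarith
    have hγ : γ ^ 2 = A - D := by linarith
    rw [hα, hγ] at this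
    rw [ht] at this ⊢
    field_simp at this ⊢
    linear_combination 1 / 4 * (A + B) ^ 2 * this
  refine ⟨μ, t, _, _, _, _, _, _, by linarith, by linarith, ht, rfl, rfl, rfl, rfl, rfl, rfl, hdet,
    gram_entries_signs hu hw hB' ⟨by linarith, by linarith⟩ ⟨by linarith, by linarith⟩ hA hD ht
      rfl rfl rfl rfl rfl hdet⟩

theorem act_apply (U : Mat3) (x : E3) (i : Fin 3) :
    act U x i = U i 0 * x 0 + U i 1 * x 1 + U i 2 * x 2 := by
  simp [act, Matrix.toLpLin_apply, Matrix.mulVec, dotProduct, Fin.sum_univ_three]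

theorem norm_sq_E3 (x : E3) : ‖x‖ ^ 2 = x 0 ^ 2 + x 1 ^ 2 + x 2 ^ 2 := by
  rw [EuclideanSpace.real_norm_sq_eq, Fin.sum_univ_three]

theorem tensor_eq (a n : E3) : tensor a n = !![a 0 * n 0, a 0 * n 1, a 0 * n 2;
    a 1 * n 0, a 1 * n 1, a 1 * n 2; a 2 * n 0, a 2 * n 1, a 2 * n 2] := by
  ext i j
  fin_cases i <;> fin_cases j <;> simp [tensor]

-- With `e = (1,1,0)`, the half turn about `e` conjugates one stretch `U` into the other. `Q` is
-- this half turn followed by the half turn about `a = U e`, which is the type II twin, with `n = e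
-- - c U a`.
open Matrix in
theorem exists_twin {p q β c : ℝ} (hc : c * (β ^ 2 + p ^ 2 + q ^ 2) = 2) :
    ∃ Q ∈ SO3, Q * !![p, 0, -q; 0, β, 0; -q, 0, p] = !![β, 0, 0; 0, p, q; 0, q, p] +
      tensor !₂[β, p, q] !₂[1 - c * β ^ 2, 1 - c * (p ^ 2 + q ^ 2), -(c * (2 * p * q))] := by
  refine ⟨!![c * β * p, c * β ^ 2 - 1, -(c * β * q); c * p ^ 2 - 1, c * p * β, -(c * p * q);
    c * p * q, c * β * q, 1 - c * q ^ 2], ⟨?_, ?_⟩, ?_⟩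
  · ext i j
    fin_cases i <;> fin_cases j <;> simp [Matrix.mul_apply, Fin.sum_univ_three]
    · linear_combination c * p * p * hc
    · linear_combination c * p * β * hc
    · linear_combination -c * p * q * hc
    · linear_combination c * β * p * hc
    · linear_combination c * β * β * hc
    · linear_combination -c * β * q * hc
    · linear_combination -c * q * p * hc
    · linear_combination -c * q * β * hc
    · linear_combination c * q * q * hc
  · simp [det_fin_three]
    linear_combination hc
  · ext i j
    fin_cases i <;> fin_cases j <;> simp [Matrix.mul_apply, Fin.sum_univ_three, tensor_eq]
    · linear_combination β * hc
    · linear_combination β * hc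
    · ring
    · linear_combination p * hc
    · linear_combination p * hc
    · ring
    · linear_combination q * hc
    · linear_combination q * hc
    · ring

open Matrix in
theorem twin_gram {p q β c μ : ℝ} (hS : β ^ 2 + p ^ 2 + q ^ 2 ≠ 0)
    (hc : c = 2 / (β ^ 2 + p ^ 2 + q ^ 2)) {G : Mat3}
    (hG : G = !![β, 0, 0; 0, p, q; 0, q, p] + μ •
      tensor !₂[β, p, q] !₂[1 - c * β ^ 2, 1 - c * (p ^ 2 + q ^ 2), -(c * (2 * p * q))])
    {A B D t e₁₁ e₁₂ e₁₃ e₂₂ e₂₃ e₃₃ : ℝ} (hA : A = p ^ 2 + q ^ 2) (hB : B = β ^ 2)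
    (hD : D = 2 * p * q) (ht : t = μ * (1 - μ) / (A + B))
    (h₁₁ : e₁₁ = B - 1 + μ * (A - B) - t * (A - B) ^ 2)
    (h₂₂ : e₂₂ = A - 1 - μ * (A - B) - t * (A - B) ^ 2)
    (h₃₃ : e₃₃ = A - 1 - 4 * t * D ^ 2)
    (h₁₂ : e₁₂ = t * (A - B) ^ 2)
    (h₁₃ : e₁₃ = -(μ * D) + 2 * t * (A - B) * D)
    (h₂₃ : e₂₃ = D - μ * D - 2 * t * (A - B) * D) :
    Gᵀ * G = 1 + !![e₁₁, e₁₂, e₁₃; e₁₂, e₂₂, e₂₃; e₁₃, e₂₃, e₃₃] := by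
  have hS' : p ^ 2 + q ^ 2 + β ^ 2 ≠ 0 := by rwa [add_comm, ← add_assoc]
  subst hA hB hD
  rw [h₁₁, h₁₂, h₁₃, h₂₂, h₂₃, h₃₃, ht, hG, hc]
  clear h₁₁ h₁₂ h₁₃ h₂₂ h₂₃ h₃₃ ht hG hc
  ext i j
  fin_cases i <;> fin_cases j <;> simp [Matrix.mul_apply, Fin.sum_univ_three, tensor_eq] <;>
    field_simp <;> ring

-- The determinant is affine in `μ` and takes the same value on both twins, hence is constant.
open Matrix in
theorem twin_det {p q β c μ : ℝ} (hc : c * (β ^ 2 + p ^ 2 + q ^ 2) = 2) :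
    (!![β, 0, 0; 0, p, q; 0, q, p] + μ • tensor !₂[β, p, q]
      !₂[1 - c * β ^ 2, 1 - c * (p ^ 2 + q ^ 2), -(c * (2 * p * q))]).det =
      β * (p ^ 2 - q ^ 2) := by
  simp [det_fin_three, tensor_eq]
  linear_combination -μ * β * (p ^ 2 - q ^ 2) * hc

/-- Moving a factor from `m` to `d` normalizes `m` as `exists_rotation_of_gram` requires; the trace
identity enters the formula for `|b|²`. -/
theorem exists_unit_of_symm_tensor {m₁ m₂ m₃ d₁ d₂ d₃ e₁₁ e₁₂ e₁₃ e₂₂ e₂₃ e₃₃ : ℝ} (hm : 0 < m₁)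
    (k₁₁ : e₁₁ = 2 * m₁ * d₁) (k₂₂ : e₂₂ = 2 * m₂ * d₂) (k₃₃ : e₃₃ = 2 * m₃ * d₃)
    (k₁₂ : e₁₂ = m₁ * d₂ + m₂ * d₁) (k₁₃ : e₁₃ = m₁ * d₃ + m₃ * d₁)
    (k₂₃ : e₂₃ = m₂ * d₃ + m₃ * d₂) :
    ∃ (N : ℝ) (m d : Fin 3 → ℝ), 0 < N ∧ m = ![m₁ / N, m₂ / N, m₃ / N] ∧ m ⬝ᵥ m = 1 ∧
      2 * (d ⬝ᵥ m) = e₁₁ + e₂₂ + e₃₃ ∧ !![e₁₁, e₁₂, e₁₃; e₁₂, e₂₂, e₂₃; e₁₃, e₂₃, e₃₃] =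
        Matrix.vecMulVec m d + Matrix.vecMulVec d m := by
  obtain ⟨N, hN, hN2⟩ : ∃ N : ℝ, 0 < N ∧ N ^ 2 = m₁ ^ 2 + m₂ ^ 2 + m₃ ^ 2 :=
    ⟨√_, Real.sqrt_pos.2 (by positivity), Real.sq_sqrt (by positivity)⟩
  refine ⟨N, _, ![d₁ * N, d₂ * N, d₃ * N], hN, rfl, ?_, ?_, ?_⟩
  · simp [dotProduct, Fin.sum_univ_three]
    field_simp
    linarith
  · rw [k₁₁, k₂₂, k₃₃]
    simp [dotProduct, Fin.sum_univ_three]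
    field_simp
  · ext i j
    fin_cases i <;> fin_cases j <;> simp <;> field_simp <;> linarith

/-- The first two entries of the normal are opposite because `e · n = 2 - c |U e|² = 0`. The signs
are thus `(+,-,-)`. -/
theorem twin_normal_bounds {p q β c : ℝ} (hp : p ∈ Icc (1.0415 : ℝ) 1.044)
    (hq : q ∈ Icc (0.0185 : ℝ) 0.021) (hβ : β ∈ Icc (0.915 : ℝ) 0.918)
    (hc : c * (β ^ 2 + p ^ 2 + q ^ 2) = 2) :
    0 < 1 - c * β ^ 2 ∧ 1 - c * (p ^ 2 + q ^ 2) = -(1 - c * β ^ 2) ∧ 0 < c * (2 * p * q) ∧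
    ‖(!₂[β, p, q] : E3)‖ * ‖(!₂[1 - c * β ^ 2, 1 - c * (p ^ 2 + q ^ 2), -(c * (2 * p * q))] : E3)‖
      ≤ 0.3 := by
  obtain ⟨hp1, hp2⟩ := hp
  obtain ⟨hq1, hq2⟩ := hq
  obtain ⟨hβ1, hβ2⟩ := hβ
  have hpp := mul_mem_bounds (by norm_num) hp1 hp2 (by norm_num) hp1 hp2
  have hqq := mul_mem_bounds (by norm_num) hq1 hq2 (by norm_num) hq1 hq2
  have hβ := mul_mem_bounds (by norm_num) hβ1 hβ2 (by norm_num) hβ1 hβ2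
  have hpq := mul_mem_bounds (by norm_num) hp1 hp2 (by norm_num) hq1 hq2
  norm_num at hpp hqq hβ hpq
  have hc' : c = 2 / (β ^ 2 + p ^ 2 + q ^ 2) := by rw [eq_div_iff (by positivity)]; exact hc
  have hc1 : 1.03 ≤ c := by rw [hc', le_div_iff₀ (by positivity)]; linarith
  have hc2 : c ≤ 1.041 := by rw [hc', div_le_iff₀ (by positivity)]; linarith
  have hcβ := mul_mem_bounds (by norm_num) hc1 hc2 (by norm_num) hβ.1 hβ.2
  have hcpq := mul_mem_bounds (by norm_num) hc1 hc2 (by norm_num) hpq.1 hpq.2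
  norm_num at hcβ hcpq
  have h1 : 1 - c * (p ^ 2 + q ^ 2) = -(1 - c * β ^ 2) := by linear_combination -hc
  refine ⟨by linarith, h1, by linarith, ?_⟩
  have ha : ‖(!₂[β, p, q] : E3)‖ ≤ 1.4 := by
    refine abs_le_of_sq_le_sq' ?_ (by norm_num) |>.2
    rw [norm_sq_E3]
    simp
    linarith
  have hn : ‖(!₂[1 - c * β ^ 2, 1 - c * (p ^ 2 + q ^ 2), -(c * (2 * p * q))] : E3)‖ ≤ 0.21 := by
    refine abs_le_of_sq_le_sq' ?_ (by norm_num) |>.2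
    rw [norm_sq_E3, h1]
    have e1 := mul_mem_bounds (x := 1 - c * β ^ 2) (y := 1 - c * β ^ 2) (a := 0) (b := 0.14)
      (c := 0) (d := 0.14) le_rfl (by linarith) (by linarith) le_rfl (by linarith) (by linarith)
    have e2 := mul_mem_bounds (x := c * (2 * p * q)) (y := c * (2 * p * q)) (a := 0) (b := 0.05)
      (c := 0) (d := 0.05) le_rfl (by linarith) (by linarith) le_rfl (by linarith) (by linarith)
    norm_num at e1 e2
    simp
    linarith
  calc _ ≤ 1.4 * 0.21 := mul_le_mul ha hn (norm_nonneg _) (by norm_num)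
    _ ≤ 0.3 := by norm_num

/-- The left side is `|b|²`. In the trace the terms linear in `μ` cancel and the terms with `t` are
nonpositive, so the bound holds for all `μ`. -/
theorem habit_correction_bound {p q β μ t e₁₁ e₂₂ e₃₃ : ℝ} (hp : p ∈ Icc (1.0415 : ℝ) 1.044)
    (hq : q ∈ Icc (0.0185 : ℝ) 0.021) (hβ : β ∈ Icc (0.915 : ℝ) 0.918) (ht : 0 ≤ t)
    {A B D : ℝ} (hA : A = p ^ 2 + q ^ 2) (hB : B = β ^ 2)
    (h₁₁ : e₁₁ = B - 1 + μ * (A - B) - t * (A - B) ^ 2)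
    (h₂₂ : e₂₂ = A - 1 - μ * (A - B) - t * (A - B) ^ 2)
    (h₃₃ : e₃₃ = A - 1 - 4 * t * D ^ 2) :
    2 + (e₁₁ + e₂₂ + e₃₃) - 2 * (β * (p ^ 2 - q ^ 2)) ≤ 0.25 ^ 2 := by
  obtain ⟨hp1, hp2⟩ := hp
  obtain ⟨hq1, hq2⟩ := hq
  obtain ⟨hβ1, hβ2⟩ := hβ
  have hpp := mul_mem_bounds (by norm_num) hp1 hp2 (by norm_num) hp1 hp2
  have hqq := mul_mem_bounds (by norm_num) hq1 hq2 (by norm_num) hq1 hq2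
  have hβ := mul_mem_bounds (by norm_num) hβ1 hβ2 (by norm_num) hβ1 hβ2
  norm_num at hpp hqq hβ
  have hd := mul_mem_bounds (y := p ^ 2 - q ^ 2) (c := 1.0842) (d := 1.09) (by norm_num) hβ1 hβ2
    (by norm_num) (by linarith) (by linarith)
  have e1 : 0 ≤ t * (A - B) ^ 2 := by positivity
  have e2 : 0 ≤ 4 * t * D ^ 2 := by positivity
  norm_num at hd
  rw [h₁₁, h₂₂, h₃₃]
  norm_num
  linarith

theorem stretch_lower_bound {p q β : ℝ} (hp : p ∈ Icc (1.0415 : ℝ) 1.044)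
    (hq : q ∈ Icc (0.0185 : ℝ) 0.021) (hβ : β ∈ Icc (0.915 : ℝ) 0.918) (x : E3) :
    9 / 10 * ‖x‖ ≤ ‖act !![β, 0, 0; 0, p, q; 0, q, p] x‖ := by
  obtain ⟨hp1, hp2⟩ := hp
  obtain ⟨hq1, hq2⟩ := hq
  obtain ⟨hβ1, hβ2⟩ := hβ
  have h1 : 0.81 ≤ (p - q) ^ 2 := by nlinarith
  have h2 : 0 ≤ p * q := mul_nonneg (by linarith) (by linarith)
  have h3 : 0.81 ≤ β ^ 2 := by nlinarith
  refine abs_le_of_sq_le_sq' ?_ (norm_nonneg _) |>.2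
  rw [mul_pow, norm_sq_E3, norm_sq_E3]
  simp only [act_apply]
  simp
  -- Here `|U x|² = β² x₀² + (p - q)² (x₁² + x₂²) + 2pq (x₁ + x₂)²`.
  have e1 := mul_le_mul_of_nonneg_right h1 (add_nonneg (sq_nonneg (x 1)) (sq_nonneg (x 2)))
  have e2 := mul_nonneg h2 (sq_nonneg (x 1 + x 2))
  have e3 := mul_le_mul_of_nonneg_right h3 (sq_nonneg (x 0))
  linarith

open Matrix in
theorem exists_isNucleusData_zero {α β γ : ℝ} (h : IsCuAlNiLattice α β γ) :
    ∃ R Q lam a n b m, IsNucleusData α β γ 0 R Q 3 lam a n b m := by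
  obtain ⟨hα1, hα2⟩ := h.alpha_mem
  obtain ⟨hβ1, hβ2⟩ := h.beta_mem
  obtain ⟨hγ1, hγ2⟩ := h.gamma_mem
  obtain ⟨p, hp⟩ : ∃ p, p = (α + γ) / 2 := ⟨_, rfl⟩
  obtain ⟨q, hq⟩ : ∃ q, q = (α - γ) / 2 := ⟨_, rfl⟩
  have hp' : p ∈ Icc (1.0415 : ℝ) 1.044 := by constructor <;> linarith
  have hq' : q ∈ Icc (0.0185 : ℝ) 0.021 := by constructor <;> linarith
  have hβ0 : 0 < β := by linarith
  have hU : variant α β γ 0 = !![β, 0, 0; 0, p, q; 0, q, p] := by simp [variant, hp, hq]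
  have hU' : variant α β γ 3 = !![p, 0, -q; 0, β, 0; -q, 0, p] := by
    simp [variant, hp, hq, neg_div']
  obtain ⟨μ, t, e₁₁, e₁₂, e₁₃, e₂₂, e₂₃, e₃₃, hμ1, hμ2, ht, h₁₁, h₂₂, h₃₃, h₁₂, h₁₃, h₂₃, hdet,
    s₁₁, s₂₂, s₃₃, s₁₃⟩ := h.exists_volume_fraction (A := p ^ 2 + q ^ 2) (B := β ^ 2)
      (D := 2 * p * q) (by rw [hp, hq]; ring) rfl (by rw [hp, hq]; ring)
  obtain ⟨m₁, m₂, m₃, d₁, d₂, d₃, hm₁, hm₂, hm₃, hpar, k₁₁, k₂₂, k₃₃, k₁₂, k₁₃, k₂₃⟩ :=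
    exists_symm_tensor_of_det_eq_zero hdet s₁₁ s₂₂ s₃₃ s₁₃
  have hS : 0 < β ^ 2 + p ^ 2 + q ^ 2 := by positivity
  obtain ⟨c, hc⟩ : ∃ c, c = 2 / (β ^ 2 + p ^ 2 + q ^ 2) := ⟨_, rfl⟩
  have hcS : c * (β ^ 2 + p ^ 2 + q ^ 2) = 2 := by rw [hc]; field_simp
  obtain ⟨Q, hQ, htw⟩ := exists_twin hcS
  obtain ⟨a, ha⟩ : ∃ a : E3, a = !₂[β, p, q] := ⟨_, rfl⟩
  obtain ⟨n, hn⟩ : ∃ n : E3, n = !₂[1 - c * β ^ 2, 1 - c * (p ^ 2 + q ^ 2), -(c * (2 * p * q))] :=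
    ⟨_, rfl⟩
  rw [← hU', ← hU, ← ha, ← hn] at htw
  obtain ⟨N, m, d, hN, hm, hmm, hdm, hmd⟩ :=
    exists_unit_of_symm_tensor hm₁ k₁₁ k₂₂ k₃₃ k₁₂ k₁₃ k₂₃
  obtain ⟨G, hG⟩ : ∃ G, G = variant α β γ 0 + μ • tensor a n := ⟨_, rfl⟩
  have hgram : Gᵀ * G = 1 + vecMulVec m d + vecMulVec d m := by
    rw [add_assoc, ← hmd]
    exact twin_gram hS.ne' hc (by rw [hG, ha, hn, hU]) rfl rfl rfl ht h₁₁ h₂₂ h₃₃ h₁₂ h₁₃ h₂₃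
  have hdetG : G.det = β * (p ^ 2 - q ^ 2) := by
    rw [hG, hU, ha, hn, twin_det hcS]
  obtain ⟨b, hR, hbb⟩ := exists_rotation_of_gram G m d hmm hgram
  obtain ⟨hn0, hn1, hn2, hnn⟩ := twin_normal_bounds hp' hq' h.beta_mem hcS
  rw [← ha, ← hn] at hnn
  have ht0 : 0 ≤ t := by
    rw [ht]
    exact div_nonneg (mul_nonneg (by linarith only [hμ1]) (by linarith only [hμ2])) (by positivity)
  have hnb : ‖(WithLp.toLp 2 b : E3)‖ ≤ 0.25 := by
    refine abs_le_of_sq_le_sq' ?_ (by norm_num) |>.2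
    rw [EuclideanSpace.real_norm_sq_eq]
    have := habit_correction_bound hp' hq' h.beta_mem ht0 rfl rfl h₁₁ h₂₂ h₃₃
    rw [← hdm, ← hdetG, ← hbb] at this
    simpa [dotProduct, pow_two] using this
  have hnm : ‖(WithLp.toLp 2 m : E3)‖ = 1 := by
    rw [EuclideanSpace.norm_eq, Real.sqrt_eq_one, ← hmm]
    simp [dotProduct, pow_two]
  refine ⟨G - vecMulVec b m, Q, 1 - μ, a, n, WithLp.toLp 2 b, WithLp.toLp 2 m, hR, hQ,
    ⟨by linarith only [hμ2], by linarith only [hμ1]⟩, ?_, ?_, ?_, htw, ?_, ?_, ?_, ?_⟩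
  · intro h0
    have := congrArg (fun v : E3 => v 0) h0
    simp [ha] at this
    exact hβ0.ne' this
  · intro h0
    have hb0 : b = 0 := congrArg (fun v : E3 => v.ofLp) h0
    have h1 := hR.1
    rw [hb0, zero_vecMulVec, sub_zero, hgram, add_assoc, add_eq_left, ← hmd] at h1
    have := congrFun (congrFun h1 0) 0
    simp at this
    exact s₁₁.ne' this
  -- If `m` were parallel to `n`, then `m` would annihilate `(1,1,0)` and `e₁₁ + 2e₁₂ + e₂₂ = A + B
  -- - 2` would vanish, whereas `β² + p² + q² < 2`.
  · rw [LinearIndependent.pair_iff]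
    intro x y hxy
    have g0 := congrArg (fun v : E3 => v 0) hxy
    have g1 := congrArg (fun v : E3 => v 1) hxy
    simp [hm, hn, hn1] at g0 g1
    have hx : x = 0 := by
      by_contra hx
      have e : x * (m₁ + m₂) = 0 := by
        field_simp at g0 g1
        linear_combination g0 + g1
      have := hpar (by linarith only [(mul_eq_zero.1 e).resolve_left hx])
      rw [h₁₁, h₁₂, h₂₂] at this
      nlinarith only [this, hp'.1, hp'.2, hq'.1, hq'.2, h.beta_mem.1, h.beta_mem.2]
    refine ⟨hx, ?_⟩
    rw [hx] at g0
    simpa [hn0.ne'] using g0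
  · rw [htw, smul_add, ← add_assoc, ← add_smul, sub_sub_cancel, sub_add_cancel, one_smul, ← hG]
    ext i j
    simp [tensor, vecMulVec_apply]
  · intro i
    fin_cases i
    · simp only [hm, hn]
      exact mul_pos (div_pos hm₁ hN) hn0
    · simp only [hm, hn, hn1]
      exact mul_pos_of_neg_of_neg (div_neg_of_neg_of_pos hm₂ hN) (neg_lt_zero.2 hn0)
    · simp only [hm, hn]
      exact mul_pos_of_neg_of_neg (div_neg_of_neg_of_pos hm₃ hN) (neg_lt_zero.2 hn2)
  -- The sum is at most `0.8 · 0.3 + 0.25`.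
  · rw [hnm, sub_sub_cancel]
    have := mul_mem_bounds (le_refl 0) (by linarith only [hμ1]) hμ2 le_rfl (by positivity) hnn
    linarith only [this.2, hnb]
  · rw [hU]
    exact stretch_lower_bound hp' hq' h.beta_mem

/-! ### Transport of the solution by cubic symmetries -/

section Orthogonal

open Matrix

theorem act_act (A B : Mat3) (x : E3) : act A (act B x) = act (A * B) x := by
  simp [act, Matrix.toLpLin_apply]

theorem norm_act_of_orthogonal {P : Mat3} (hP : Pᵀ * P = 1) (x : E3) : ‖act P x‖ = ‖x‖ := by
  have h : (P *ᵥ x.ofLp) ⬝ᵥ (P *ᵥ x.ofLp) = x.ofLp ⬝ᵥ x.ofLp := by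
    rw [dotProduct_mulVec, ← mulVec_transpose, mulVec_mulVec, hP, one_mulVec]
  rw [EuclideanSpace.norm_eq, EuclideanSpace.norm_eq]
  congr 1
  simpa [act, toLpLin_apply, dotProduct, pow_two] using h

/-- `P` may be a reflection; its determinant enters twice. -/
theorem conj_mem_SO3 {P R : Mat3} (hP : P * Pᵀ = 1) (hR : R ∈ SO3) : P * R * Pᵀ ∈ SO3 := by
  have hP' : Pᵀ * P = 1 := mul_eq_one_comm.1 hP
  refine ⟨?_, ?_⟩
  · calc (P * R * Pᵀ)ᵀ * (P * R * Pᵀ) = P * (Rᵀ * (Pᵀ * P) * R) * Pᵀ := by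
          simp only [transpose_mul, transpose_transpose, Matrix.mul_assoc]
      _ = 1 := by rw [hP', Matrix.mul_one, hR.1, Matrix.mul_one, hP]
  · have := congrArg Matrix.det hP
    rw [det_mul, det_one] at this
    rw [det_mul, det_mul, mul_right_comm, this, hR.2, one_mul]

theorem conj_tensor (P : Mat3) (a n : E3) : P * tensor a n * Pᵀ = tensor (act P a) (act P n) := by
  have h : ∀ a n : E3, tensor a n = vecMulVec a.ofLp n.ofLp := fun a n => by
    ext i j; simp [tensor, vecMulVec_apply]
  rw [h, h, mul_vecMulVec, vecMulVec_mul, vecMul_transpose]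
  simp [act, toLpLin_apply]

/-- Both equations are equivariant under conjugation by an orthogonal `P`. Only the sign condition
depends on the axes, and signed permutations preserve it because the sign of an axis enters `m_i
n_i` twice. -/
theorem IsNucleusData.conj {α β γ : ℝ} {s l s' l' : Fin 6} {R Q : Mat3} {lam : ℝ} {a n b m : E3}
    (h : IsNucleusData α β γ s R Q l lam a n b m) {P : Mat3} (hP : P * Pᵀ = 1)
    (hsign : ∀ x y : E3, (∀ i, 0 < x i * y i) → ∀ i, 0 < act P x i * act P y i)
    (hs : variant α β γ s' = P * variant α β γ s * Pᵀ)
    (hl : variant α β γ l' = P * variant α β γ l * Pᵀ) :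
    IsNucleusData α β γ s' (P * R * Pᵀ) (P * Q * Pᵀ) l' lam (act P a) (act P n) (act P b)
      (act P m) := by
  have hP' : Pᵀ * P = 1 := mul_eq_one_comm.1 hP
  have hinj : ∀ x, act P x = 0 → x = 0 := fun x hx => by
    rw [← norm_eq_zero, ← norm_act_of_orthogonal hP' x, hx, norm_zero]
  have hQl : P * Q * Pᵀ * (P * variant α β γ l * Pᵀ) = P * (Q * variant α β γ l) * Pᵀ :=
    calc _ = P * (Q * (Pᵀ * P) * variant α β γ l) * Pᵀ := by simp only [Matrix.mul_assoc]
      _ = _ := by rw [hP', Matrix.mul_one]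
  refine ⟨conj_mem_SO3 hP h.R_mem, conj_mem_SO3 hP h.Q_mem, h.lam_mem, fun h0 => h.a_ne (hinj _ h0),
    fun h0 => h.b_ne (hinj _ h0), ?_, ?_, ?_, hsign _ _ h.sign, ?_, ?_⟩
  · have := h.indep
    rw [LinearIndependent.pair_iff] at this ⊢
    intro x y hxy
    refine this x y (hinj _ ?_)
    rw [← hxy]
    simp [act]
  · rw [hs, hl, hQl, h.twin, Matrix.mul_add, Matrix.add_mul, conj_tensor]
  · rw [hs, hl, hQl, ← conj_tensor, ← Matrix.add_mul, ← Matrix.mul_add, ← h.habit]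
    simp [Matrix.mul_add, Matrix.add_mul]
  · simpa only [norm_act_of_orthogonal hP'] using h.small
  · intro x
    have hPt : Pᵀᵀ * Pᵀ = 1 := by rwa [transpose_transpose]
    have := h.bound (act Pᵀ x)
    rwa [norm_act_of_orthogonal hPt, ← norm_act_of_orthogonal hP' (act _ _), act_act, act_act,
      ← hs] at this

theorem exists_isNucleusData {α β γ : ℝ} (h : IsCuAlNiLattice α β γ) (s : Fin 6) :
    ∃ R Q l lam a n b m, IsNucleusData α β γ s R Q l lam a n b m := by
  obtain ⟨R, Q, lam, a, n, b, m, h0⟩ := exists_isNucleusData_zero h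
  have key : ∀ (P : Mat3) (l : Fin 6), P * Pᵀ = 1 →
      (∀ x y : E3, (∀ i, 0 < x i * y i) → ∀ i, 0 < act P x i * act P y i) →
      variant α β γ s = P * variant α β γ 0 * Pᵀ → variant α β γ l = P * variant α β γ 3 * Pᵀ →
      ∃ R Q l lam a n b m, IsNucleusData α β γ s R Q l lam a n b m :=
    fun P l hP hsg hs hl => ⟨_, _, l, _, _, _, _, _, h0.conj hP hsg hs hl⟩
  fin_cases s
  · exact ⟨R, Q, 3, lam, a, n, b, m, h0⟩
  · refine key !![1, 0, 0; 0, 1, 0; 0, 0, -1] 2 ?_ ?_ ?_ ?_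
    rotate_left
    · intro x y hxy i
      fin_cases i
      · simpa [act_apply] using hxy 0
      · simpa [act_apply] using hxy 1
      · simpa [act_apply] using hxy 2
    all_goals
      ext i j
      fin_cases i <;> fin_cases j <;>
        simp [variant, Matrix.mul_apply, Fin.sum_univ_three, neg_div']
  · refine key !![0, 1, 0; 1, 0, 0; 0, 0, 1] 1 ?_ ?_ ?_ ?_
    rotate_left
    · intro x y hxy i
      fin_cases i
      · simpa [act_apply] using hxy 1
      · simpa [act_apply] using hxy 0
      · simpa [act_apply] using hxy 2
    all_goals
      ext i j
      fin_cases i <;> fin_cases j <;>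
        simp [variant, Matrix.mul_apply, Fin.sum_univ_three]
  · refine key !![0, 1, 0; 1, 0, 0; 0, 0, -1] 0 ?_ ?_ ?_ ?_
    rotate_left
    · intro x y hxy i
      fin_cases i
      · simpa [act_apply] using hxy 1
      · simpa [act_apply] using hxy 0
      · simpa [act_apply] using hxy 2
    all_goals
      ext i j
      fin_cases i <;> fin_cases j <;>
        simp [variant, Matrix.mul_apply, Fin.sum_univ_three, neg_div']
  · refine key !![0, 0, 1; 0, 1, 0; 1, 0, 0] 3 ?_ ?_ ?_ ?_
    rotate_left
    · intro x y hxy i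
      fin_cases i
      · simpa [act_apply] using hxy 2
      · simpa [act_apply] using hxy 1
      · simpa [act_apply] using hxy 0
    all_goals
      ext i j
      fin_cases i <;> fin_cases j <;>
        simp [variant, Matrix.mul_apply, Fin.sum_univ_three]
  · refine key !![0, 0, -1; 0, 1, 0; 1, 0, 0] 2 ?_ ?_ ?_ ?_
    rotate_left
    · intro x y hxy i
      fin_cases i
      · simpa [act_apply] using hxy 2
      · simpa [act_apply] using hxy 1
      · simpa [act_apply] using hxy 0
    all_goals
      ext i j
      fin_cases i <;> fin_cases j <;>
        simp [variant, Matrix.mul_apply, Fin.sum_univ_three, neg_div']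

end Orthogonal

/-! ### Geometry of a bar near a corner -/

/-- The edge directions pointing from the corner `c` into the bar. -/
def Bar.inward (P : Bar) (c : Fin 3 → Bool) (i : Fin 3) : E3 :=
  (if c i then -1 else 1 : ℝ) • P.frame i

theorem Bar.inner_frame_corner (P : Bar) (c : Fin 3 → Bool) (i : Fin 3) :
    inner ℝ (P.frame i) (P.corner c - P.vertex) = if c i then P.len i else 0 := by
  rw [Bar.corner, add_sub_cancel_left, P.frame.orthonormal.inner_right_fintype]

theorem Bar.isOpen_region (P : Bar) : IsOpen P.region := by
  have : P.region = ⋂ i, {x | inner ℝ (P.frame i) (x - P.vertex) ∈ Ioo 0 (P.len i)} := by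
    ext x; simp [Bar.region]
  rw [this]
  exact isOpen_iInter_of_finite fun i => isOpen_Ioo.preimage (by fun_prop)

theorem Bar.inner_mem_Icc_of_mem_closure (P : Bar) {x : E3} (hx : x ∈ closure P.region)
    (i : Fin 3) : inner ℝ (P.frame i) (x - P.vertex) ∈ Icc 0 (P.len i) := by
  have hcl : IsClosed {x : E3 | inner ℝ (P.frame i) (x - P.vertex) ∈ Icc 0 (P.len i)} :=
    isClosed_Icc.preimage (by fun_prop)
  have hsub : P.region ⊆ {x : E3 | inner ℝ (P.frame i) (x - P.vertex) ∈ Icc 0 (P.len i)} :=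
    fun y hy => Ioo_subset_Icc_self (hy i)
  exact closure_minimal hsub hcl hx

theorem Bar.inner_inward_nonneg (P : Bar) (c : Fin 3 → Bool) {x : E3}
    (hx : x ∈ closure P.region) (i : Fin 3) :
    0 ≤ inner ℝ (P.inward c i) (x - P.corner c) := by
  have h := P.inner_mem_Icc_of_mem_closure hx i
  have h2 := P.inner_frame_corner c i
  rw [← sub_sub_sub_cancel_right x (P.corner c) P.vertex, inner_sub_right, Bar.inward,
    real_inner_smul_left, real_inner_smul_left, h2]
  split_ifs <;> simp <;> linarith [h.1, h.2]

theorem Bar.sub_corner_eq_sum (P : Bar) (c : Fin 3 → Bool) (x : E3) :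
    x - P.corner c = ∑ i, inner ℝ (P.inward c i) (x - P.corner c) • P.inward c i := by
  conv_lhs => rw [← P.frame.sum_repr' (x - P.corner c)]
  refine Finset.sum_congr rfl fun i _ => ?_
  rw [Bar.inward, real_inner_smul_left, smul_smul]
  split_ifs <;> simp

theorem Bar.norm_inward (P : Bar) (c : Fin 3 → Bool) (i : Fin 3) : ‖P.inward c i‖ = 1 := by
  rw [Bar.inward, norm_smul, P.frame.norm_eq_one]
  split_ifs <;> simp

theorem Bar.corner_mem_closure (P : Bar) (c : Fin 3 → Bool) : P.corner c ∈ closure P.region := by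
  let w : E3 := ∑ i, P.len i • P.inward c i
  have hlim : Tendsto (fun t : ℝ => P.corner c + t • w) (𝓝[>] 0) (𝓝 (P.corner c)) := by
    have : Continuous fun t : ℝ => P.corner c + t • w := by fun_prop
    simpa using (this.tendsto 0).mono_left nhdsWithin_le_nhds
  refine mem_closure_of_tendsto hlim ?_
  filter_upwards [Ioo_mem_nhdsGT one_pos] with t ht i
  have hw : inner ℝ (P.frame i) w = P.len i * (if c i then -1 else 1) := by
    simp only [w, Bar.inward, smul_smul]
    exact P.frame.orthonormal.inner_right_fintype _ i
  rw [add_sub_right_comm, inner_add_right, P.inner_frame_corner, real_inner_smul_right, hw]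
  have := P.len_pos i
  have h1 := mul_pos ht.1 this
  have h2 := mul_pos (sub_pos.2 ht.2) this
  split_ifs <;> constructor <;> nlinarith

/-- Half spaces cutting off a corner. -/
theorem Bar.exists_cuts (P : Bar) (c : Fin 3 → Bool) {m n : E3}
    (hm : ∀ i, 0 < inner ℝ m (P.inward c i)) (hn : ∀ i, 0 < inner ℝ n (P.inward c i))
    {r : ℝ} (hr : 0 < r) :
    ∃ c₁ c₂ : ℝ, 0 < c₁ ∧ 0 < c₂ ∧
      (∀ x ∈ closure P.region, inner ℝ m (x - P.corner c) ≤ c₁ →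
        inner ℝ n (x - P.corner c) < c₂) ∧
      ∀ x ∈ closure P.region, inner ℝ n (x - P.corner c) < c₂ → ‖x - P.corner c‖ < r := by
  -- In the closed bar `x - v` is a nonnegative combination of the unit inward edges, so `w · (x -
  -- v) ≥ κ ∑ t_i ≥ κ |x - v|`.
  have lower : ∀ {w : E3}, (∀ i, 0 < inner ℝ w (P.inward c i)) → ∃ κ : ℝ, 0 < κ ∧
      ∀ x ∈ closure P.region, κ * ‖x - P.corner c‖ ≤ inner ℝ w (x - P.corner c) := by
    intro w hw
    obtain ⟨κ, hκ, hκw⟩ : ∃ κ : ℝ, 0 < κ ∧ ∀ i, κ ≤ inner ℝ w (P.inward c i) := by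
      obtain ⟨i, hi⟩ := Finite.exists_min fun i => inner ℝ w (P.inward c i)
      exact ⟨_, hw i, hi⟩
    refine ⟨κ, hκ, fun x hx => ?_⟩
    have ht := P.inner_inward_nonneg c hx
    have hsum := P.sub_corner_eq_sum c x
    obtain ⟨t, ht'⟩ : ∃ t : Fin 3 → ℝ, ∀ i, inner ℝ (P.inward c i) (x - P.corner c) = t i :=
      ⟨_, fun _ => rfl⟩
    simp only [ht'] at ht hsum
    rw [hsum]
    calc κ * ‖∑ i, t i • P.inward c i‖ ≤ κ * ∑ i, t i := by
          refine mul_le_mul_of_nonneg_left ((norm_sum_le _ _).trans (Finset.sum_le_sum fun i _ => ?_))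
            hκ.le
          rw [norm_smul, P.norm_inward, mul_one, Real.norm_of_nonneg (ht i)]
      _ ≤ ∑ i, t i * inner ℝ w (P.inward c i) := by
          rw [Finset.mul_sum]
          refine Finset.sum_le_sum fun i _ => ?_
          rw [mul_comm]
          exact mul_le_mul_of_nonneg_left (hκw i) (ht i)
      _ = _ := by simp_rw [inner_sum, real_inner_smul_right]
  obtain ⟨κ, hκ, hκm⟩ := lower hm
  obtain ⟨κ', hκ', hκn⟩ := lower hn
  have hnpos : 0 < ‖n‖ := norm_pos_iff.2 fun h => by simpa [h] using hn 0
  -- `c₂ = κ' r` confines the nucleus to the ball of radius `r`. The austenite region has `|x - v| ≤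
  -- c₁/κ`, hence `n · (x - v) ≤ c₂/2`, with room for a strict inequality.
  refine ⟨κ * (κ' * r) / (2 * ‖n‖), κ' * r, by positivity, by positivity, fun x hx h => ?_,
    fun x hx h => ?_⟩
  · have h1 := (hκm x hx).trans h
    have h2 : ‖n‖ * ‖x - P.corner c‖ ≤ κ' * r / 2 := by
      rw [le_div_iff₀ (by positivity)] at h1
      refine le_of_mul_le_mul_left ?_ hκ
      linarith
    have h3 := real_inner_le_norm n (x - P.corner c)
    have : 0 < κ' * r := by positivity
    linarith
  · exact lt_of_mul_lt_mul_left ((hκn x hx).trans_lt h) hκ'.le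

/-- By Cauchy–Schwarz, tilting an axis by less than `ε` changes `m_i` by less than the smallest
`|m_j|`, so no sign changes. -/
theorem exists_alignment_tolerance {m : E3} (hm : ∀ i, m i ≠ 0) :
    ∃ ε : ℝ, 0 < ε ∧ ∀ P : Bar, P.AlignedWithin ε → ∀ i, 0 < m i * inner ℝ m (P.frame i) := by
  obtain ⟨i₀, hi₀⟩ := Finite.exists_min fun i => |m i|
  have h0 : 0 < |m i₀| := abs_pos.2 (hm i₀)
  refine ⟨|m i₀| / (‖m‖ + 1), by positivity, fun P hP i => ?_⟩
  have h1 : |inner ℝ m (P.frame i) - m i| < |m i| := by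
    have : inner ℝ m (P.frame i) - m i = inner ℝ m (P.frame i - EuclideanSpace.single i 1) := by
      rw [inner_sub_right, EuclideanSpace.inner_single_right]; simp
    rw [this]
    have h2 := hP i
    rw [lt_div_iff₀ (by positivity)] at h2
    have h3 := abs_real_inner_le_norm m (P.frame i - EuclideanSpace.single i 1)
    have h4 := hi₀ i
    have h5 := norm_nonneg (P.frame i - EuclideanSpace.single i 1)
    linarith
  have h2 : |m i * (inner ℝ m (P.frame i) - m i)| < m i * m i := by
    rw [abs_mul, ← abs_mul_abs_self (m i)]
    exact mul_lt_mul_of_pos_left h1 (abs_pos.2 (hm i))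
  linarith [(abs_lt.1 h2).1]

/-! ### Weak limits of rapidly oscillating functions -/

/-- Translation is continuous in `L¹`. -/
theorem tendsto_integral_abs_translate_sub {h : E3 → ℝ} (hh : Integrable h) :
    Tendsto (fun t : E3 => ∫ x, |h (t + x) - h x|) (𝓝 0) (𝓝 0) := by
  have hm : MemLp h 1 volume := memLp_one_iff_integrable.2 hh
  have : Fact ((1 : ℝ≥0∞) ≠ ∞) := ⟨ENNReal.one_ne_top⟩
  have hcont : Continuous fun t : E3 => (DomAddAct.mk t) +ᵥ hm.toLp h :=
    (DomAddAct.continuous_mk).vadd continuous_const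
  have h0 := (hcont.tendsto 0).sub_const (hm.toLp h) |>.norm
  rw [show (DomAddAct.mk (0 : E3)) +ᵥ hm.toLp h = hm.toLp h from zero_vadd _ _, sub_self,
    norm_zero] at h0
  refine h0.congr fun t => ?_
  rw [DomAddAct.mk_vadd_toLp, ← MemLp.toLp_sub, Lp.norm_toLp, eLpNorm_one_eq_lintegral_enorm,
    ← integral_norm_eq_lintegral_enorm]
  · rfl
  · exact (hm.comp_measurePreserving (measurePreserving_vadd t volume)).1.sub hm.1

/-- Shifting `x` by a vector of length `O(1/k)` along `n` shifts the phase by any `s ∈ [0,1]`, and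
changes the integral little because translation is continuous in `L¹`. Averaging over `s` replaces
`χ` by its mean. -/
theorem tendsto_integral_mul_periodic {h : E3 → ℝ} (hh : Integrable h) {χ : ℝ → ℝ}
    (hχ : Measurable χ) (hper : Function.Periodic χ 1) (hb : ∀ t, |χ t| ≤ 1) {n : E3} (hn : n ≠ 0)
    {φ : E3 → ℝ} (hφ : Measurable φ) (hφn : ∀ x y, φ (x + y) = inner ℝ n x + φ y) :
    Tendsto (fun k : ℕ => ∫ x, h x * χ ((k + 1) * φ x)) atTop
      (𝓝 (∫ x, h x * ∫ s in (0 : ℝ)..1, χ s)) := by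
  have hnn : 0 < ‖n‖ ^ 2 := by positivity
  rw [Metric.tendsto_atTop]
  intro ε hε
  obtain ⟨δ, hδ, hδε⟩ := Metric.eventually_nhds_iff.1
    ((tendsto_integral_abs_translate_sub hh).eventually_lt_const (half_pos hε))
  obtain ⟨N, hN⟩ := exists_nat_gt (‖(‖n‖ ^ 2)⁻¹ • n‖ / δ)
  refine ⟨N, fun k hk => ?_⟩
  have hK : (0 : ℝ) < k + 1 := by positivity
  have hkδ : ‖(‖n‖ ^ 2)⁻¹ • n‖ < δ * (k + 1) := by
    rw [div_lt_iff₀ hδ] at hN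
    have : (N : ℝ) ≤ k := by exact_mod_cast hk
    nlinarith
  obtain ⟨J, hJ⟩ : ∃ J, J = ∫ x, h x * χ ((k + 1) * φ x) := ⟨_, rfl⟩
  have hmeas : Measurable fun p : ℝ × E3 => χ ((k + 1) * φ p.2 + p.1) :=
    hχ.comp (((hφ.comp measurable_snd).const_mul _).add measurable_fst)
  have hint : Integrable (fun p : ℝ × E3 => h p.2 * χ ((k + 1) * φ p.2 + p.1))
      ((volume.restrict (Ioc 0 1)).prod volume) := by
    refine (hh.comp_snd (volume.restrict (Ioc (0 : ℝ) 1))).mul_bdd (c := 1) hmeas.aestronglyMeasurable ?_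
    exact Eventually.of_forall fun p => hb _
  have hH : ∫ s in (0 : ℝ)..1, ∫ x, h x * χ ((k + 1) * φ x + s) =
      ∫ x, h x * ∫ s in (0 : ℝ)..1, χ s := by
    rw [intervalIntegral.integral_of_le zero_le_one, integral_integral_swap hint]
    refine integral_congr_ae (Eventually.of_forall fun x => ?_)
    simp only
    rw [integral_const_mul, ← intervalIntegral.integral_of_le zero_le_one,
      intervalIntegral.integral_comp_add_left (fun s => χ s), add_zero,
      hper.intervalIntegral_add_eq _ 0, zero_add]
  have hHint : IntervalIntegrable (fun s => ∫ x, h x * χ ((k + 1) * φ x + s)) volume 0 1 := by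
    rw [intervalIntegrable_iff_integrableOn_Ioc_of_le zero_le_one]
    exact hint.integral_prod_left
  have hJs : ∀ s ∈ uIoc (0 : ℝ) 1, ‖J - ∫ x, h x * χ ((k + 1) * φ x + s)‖ ≤ ε / 2 := by
    intro s hs
    rw [uIoc_of_le zero_le_one] at hs
    -- This is the translation with `(k + 1) n · w = s`.
    obtain ⟨w, hw⟩ : ∃ w : E3, w = (s / (k + 1)) • (‖n‖ ^ 2)⁻¹ • n := ⟨_, rfl⟩
    have hnw : inner ℝ n w = s / (k + 1) := by
      rw [hw, real_inner_smul_right, real_inner_smul_right, real_inner_self_eq_norm_sq]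
      field_simp
    have hwδ : dist w 0 < δ := by
      rw [dist_zero_right, hw, norm_smul, Real.norm_of_nonneg (by have := hs.1; positivity),
        div_mul_eq_mul_div, div_lt_iff₀ hK]
      exact (mul_le_of_le_one_left (norm_nonneg _) hs.2).trans_lt hkδ
    have hJ' : J = ∫ x, h (w + x) * χ ((k + 1) * φ x + s) := by
      rw [hJ, ← integral_add_left_eq_self _ w]
      refine integral_congr_ae (Eventually.of_forall fun x => ?_)
      simp only
      rw [hφn, hnw, mul_add, mul_div_cancel₀ _ hK.ne', add_comm s]
    have hm2 : Measurable fun x => χ ((k + 1) * φ x + s) :=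
      hχ.comp ((hφ.const_mul _).add_const _)
    have i1 : Integrable fun x => h (w + x) * χ ((k + 1) * φ x + s) :=
      (hh.comp_add_left w).mul_bdd (c := 1) hm2.aestronglyMeasurable
        (Eventually.of_forall fun p => hb _)
    have i2 : Integrable fun x => h x * χ ((k + 1) * φ x + s) :=
      hh.mul_bdd (c := 1) hm2.aestronglyMeasurable (Eventually.of_forall fun p => hb _)
    rw [hJ', ← integral_sub i1 i2]
    refine (norm_integral_le_of_norm_le ((hh.comp_add_left w).sub hh).abs
      (Eventually.of_forall fun x => ?_)).trans (hδε hwδ).le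
    rw [← sub_mul, norm_mul]
    exact mul_le_of_le_one_right (norm_nonneg _) (hb _)
  have hfin := intervalIntegral.norm_integral_le_of_norm_le_const hJs
  rw [intervalIntegral.integral_sub intervalIntegrable_const hHint, hH] at hfin
  simp only [intervalIntegral.integral_const, sub_zero, one_smul, abs_one, mul_one] at hfin
  rw [← hJ, dist_eq_norm]
  linarith

/-! ### The sawtooth function -/

/-- The `1`-periodic function with slope `1 - μ` on `[0, μ]` and slope `-μ` on `[μ, 1]`. -/
def sawtooth (μ τ : ℝ) : ℝ := min ((1 - μ) * Int.fract τ) (μ * (1 - Int.fract τ))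

/-- The `1`-periodic indicator function of `[0, μ)`. -/
def phase (μ τ : ℝ) : ℝ := if Int.fract τ < μ then 1 else 0

theorem sawtooth_nonneg {μ : ℝ} (h0 : 0 ≤ μ) (h1 : μ ≤ 1) (τ : ℝ) : 0 ≤ sawtooth μ τ :=
  le_min (mul_nonneg (sub_nonneg.2 h1) (Int.fract_nonneg τ))
    (mul_nonneg h0 (sub_nonneg.2 (Int.fract_lt_one τ).le))

theorem sawtooth_le_one {μ : ℝ} (h0 : 0 ≤ μ) (τ : ℝ) : sawtooth μ τ ≤ 1 :=
  (min_le_left _ _).trans (by nlinarith [Int.fract_nonneg τ, Int.fract_lt_one τ])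

theorem sawtooth_zero {μ : ℝ} (h0 : 0 ≤ μ) : sawtooth μ 0 = 0 := by simp [sawtooth, h0]

theorem sawtooth_of_le {μ τ : ℝ} (h : Int.fract τ ≤ μ) :
    sawtooth μ τ = (1 - μ) * Int.fract τ := min_eq_left (by linarith)

theorem sawtooth_of_ge {μ τ : ℝ} (h : μ ≤ Int.fract τ) :
    sawtooth μ τ = μ * (1 - Int.fract τ) := min_eq_right (by linarith)

/-- The sawtooth is the lower envelope of the translates of an asymmetric absolute value. -/
theorem sawtooth_le_max {μ : ℝ} (h0 : 0 ≤ μ) (h1 : μ ≤ 1) (τ : ℝ) (j : ℤ) :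
    sawtooth μ τ ≤ max ((1 - μ) * (τ - j)) (-(μ * (τ - j))) := by
  have hτ := Int.floor_add_fract τ
  rcases le_or_gt j ⌊τ⌋ with h | h
  · have : (j : ℝ) ≤ ⌊τ⌋ := by exact_mod_cast h
    exact (min_le_left _ _).trans ((mul_le_mul_of_nonneg_left (by linarith)
      (sub_nonneg.2 h1)).trans (le_max_left _ _))
  · have : (⌊τ⌋ : ℝ) + 1 ≤ j := by exact_mod_cast h
    refine (min_le_right _ _).trans (le_trans ?_ (le_max_right _ _))
    rw [← mul_neg]
    exact mul_le_mul_of_nonneg_left (by linarith) h0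

theorem exists_sawtooth_eq_max (μ τ : ℝ) :
    ∃ j : ℤ, max ((1 - μ) * (τ - j)) (-(μ * (τ - j))) = sawtooth μ τ := by
  have hτ := Int.floor_add_fract τ
  have hf0 := Int.fract_nonneg τ
  have hf1 := Int.fract_lt_one τ
  rcases le_total (Int.fract τ) μ with h | h
  · refine ⟨⌊τ⌋, ?_⟩
    rw [sawtooth_of_le h, max_eq_left, show τ - ⌊τ⌋ = Int.fract τ by linarith]
    nlinarith
  · refine ⟨⌊τ⌋ + 1, ?_⟩
    have : τ - ((⌊τ⌋ + 1 : ℤ) : ℝ) = -(1 - Int.fract τ) := by push_cast; linarith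
    rw [sawtooth_of_ge h, this, max_eq_right]
    · ring
    · nlinarith

/-- An attained minimum of `1`-Lipschitz functions is `1`-Lipschitz. -/
theorem lipschitzWith_sawtooth {μ : ℝ} (h0 : 0 ≤ μ) (h1 : μ ≤ 1) :
    LipschitzWith 1 (sawtooth μ) := by
  refine LipschitzWith.of_le_add fun σ τ => ?_
  obtain ⟨j, hj⟩ := exists_sawtooth_eq_max μ τ
  rw [← hj, Real.dist_eq]
  refine (sawtooth_le_max h0 h1 σ j).trans (max_le ?_ ?_)
  · have := le_max_left ((1 - μ) * (τ - j)) (-(μ * (τ - j)))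
    nlinarith [le_abs_self (σ - τ), abs_nonneg (σ - τ)]
  · have := le_max_right ((1 - μ) * (τ - j)) (-(μ * (τ - j)))
    nlinarith [neg_abs_le (σ - τ), abs_nonneg (σ - τ)]

/-- Off the kinks the slope is `phase - μ`; added to the mean slope `μ` it leaves `1` or `0`, that
is, one twin or the other. -/
theorem eventually_sawtooth_eq {μ τ : ℝ} (hτ : Int.fract τ ≠ 0) (hτ' : Int.fract τ ≠ μ) :
    ∀ᶠ σ in 𝓝 τ, sawtooth μ σ = sawtooth μ τ + (phase μ τ - μ) * (σ - τ) := by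
  have hfl := Int.floor_add_fract τ
  have hf0 : 0 < Int.fract τ := lt_of_le_of_ne (Int.fract_nonneg τ) hτ.symm
  have hf1 := Int.fract_lt_one τ
  have hfr : ∀ {σ : ℝ}, σ ∈ Ioo (⌊τ⌋ : ℝ) (⌊τ⌋ + 1) → Int.fract σ = σ - ⌊τ⌋ := fun {σ} hσ => by
    rw [Int.fract, Int.floor_eq_iff.2 ⟨hσ.1.le, hσ.2⟩]
  have h1 : ∀ᶠ σ in 𝓝 τ, σ ∈ Ioo (⌊τ⌋ : ℝ) (⌊τ⌋ + 1) :=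
    Ioo_mem_nhds (by linarith) (by linarith)
  rcases lt_or_gt_of_ne hτ' with h | h
  · have h2 : ∀ᶠ σ in 𝓝 τ, σ < ⌊τ⌋ + μ := Iio_mem_nhds (by linarith)
    filter_upwards [h1, h2] with σ hσ hσ2
    rw [phase, if_pos h, sawtooth_of_le h.le, sawtooth_of_le (by rw [hfr hσ]; linarith), hfr hσ]
    linear_combination -(1 - μ) * hfl
  · have h2 : ∀ᶠ σ in 𝓝 τ, ⌊τ⌋ + μ < σ := Ioi_mem_nhds (by linarith)
    filter_upwards [h1, h2] with σ hσ hσ2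
    rw [phase, if_neg h.not_gt, sawtooth_of_ge h.le, sawtooth_of_ge (by rw [hfr hσ]; linarith),
      hfr hσ]
    linear_combination μ * hfl

theorem measurable_phase (μ : ℝ) : Measurable (phase μ) :=
  Measurable.ite (measurableSet_lt measurable_fract measurable_const) measurable_const
    measurable_const

theorem periodic_phase (μ : ℝ) : Function.Periodic (phase μ) 1 := fun τ => by
  rw [phase, Int.fract_add_one, phase]

theorem abs_phase_le_one (μ τ : ℝ) : |phase μ τ| ≤ 1 := by
  rw [phase]; split_ifs <;> simp

theorem integral_phase {μ : ℝ} (h0 : 0 ≤ μ) (h1 : μ ≤ 1) :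
    ∫ τ in (0 : ℝ)..1, phase μ τ = μ := by
  rw [intervalIntegral.integral_of_le zero_le_one, integral_Ioc_eq_integral_Ioo]
  have : EqOn (phase μ) ((Iio μ).indicator 1) (Ioo 0 1) := fun τ hτ => by
    rw [phase, Int.fract_eq_self.2 ⟨hτ.1.le, hτ.2⟩, indicator_apply]
    rfl
  rw [setIntegral_congr_fun measurableSet_Ioo this, integral_indicator_one measurableSet_Iio,
    measureReal_restrict_apply measurableSet_Iio, Iio_inter_Ioo, min_eq_left h1]
  simp [h0]

/-- A sawtooth of period `1 / K`, switched off on the positive half line. -/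
def sawtoothCut (μ K t : ℝ) : ℝ := sawtooth μ (K * min t 0) / K

theorem lipschitzWith_sawtoothCut {μ K : ℝ} (h0 : 0 ≤ μ) (h1 : μ ≤ 1) (hK : 0 < K) :
    LipschitzWith 1 (sawtoothCut μ K) := by
  refine LipschitzWith.of_dist_le_mul fun s t => ?_
  have h := (lipschitzWith_sawtooth h0 h1).dist_le_mul (K * min s 0) (K * min t 0)
  have h2 := (LipschitzWith.id.min_const 0).dist_le_mul s t
  simp only [Real.dist_eq, sawtoothCut, NNReal.coe_one, one_mul, id] at *
  rw [← sub_div, abs_div, abs_of_pos hK, div_le_iff₀ hK]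
  rw [← mul_sub, abs_mul, abs_of_pos hK] at h
  nlinarith

theorem sawtoothCut_nonneg {μ K : ℝ} (h0 : 0 ≤ μ) (h1 : μ ≤ 1) (hK : 0 < K) (t : ℝ) :
    0 ≤ sawtoothCut μ K t := div_nonneg (sawtooth_nonneg h0 h1 _) hK.le

theorem sawtoothCut_le {μ K : ℝ} (h0 : 0 ≤ μ) (hK : 0 < K) (t : ℝ) :
    sawtoothCut μ K t ≤ 1 / K := div_le_div_of_nonneg_right (sawtooth_le_one h0 _) hK.le

theorem sawtoothCut_of_nonneg {μ K t : ℝ} (h0 : 0 ≤ μ) (ht : 0 ≤ t) : sawtoothCut μ K t = 0 := by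
  rw [sawtoothCut, min_eq_right ht, mul_zero, sawtooth_zero h0, zero_div]

theorem eventually_sawtoothCut_eq {μ K t : ℝ} (hK : 0 < K) (ht : t < 0)
    (h : Int.fract (K * t) ≠ 0) (h' : Int.fract (K * t) ≠ μ) :
    ∀ᶠ s in 𝓝 t, sawtoothCut μ K s = sawtoothCut μ K t + (phase μ (K * t) - μ) * (s - t) := by
  have hc : Tendsto (fun s => K * s) (𝓝 t) (𝓝 (K * t)) := (continuous_const_mul K).tendsto t
  filter_upwards [hc.eventually (eventually_sawtooth_eq h h'), Iio_mem_nhds ht] with s hs hs0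
  rw [sawtoothCut, sawtoothCut, min_eq_left (le_of_lt hs0), min_eq_left ht.le, hs]
  field_simp

/-! ### Layered deformations -/

/-- A deformation with gradient `U` for `0 < p`, `0 < q`, and with rank-one corrections in the
directions `a` (for `p < 0`) and `b` (for `q < 0`). The function `w` describes a fine laminate in the
region `p < 0 < q`. -/
def layered (U : Mat3) (a b : E3) (μ : ℝ) (p q : E3 → ℝ) (w : ℝ → ℝ) (x : E3) : E3 :=
  act U x + min (p x) 0 • μ • a - min (q x) 0 • b + min (w (p x)) (max (q x) 0) • a

theorem lipschitzWith_smul_const {f : E3 → ℝ} {K : ℝ≥0} (hf : LipschitzWith K f) (a : E3) :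
    LipschitzWith (K * ‖a‖₊) fun x => f x • a := by
  refine LipschitzWith.of_dist_le_mul fun x y => ?_
  rw [dist_eq_norm, ← sub_smul, norm_smul, NNReal.coe_mul, coe_nnnorm, mul_right_comm]
  exact mul_le_mul_of_nonneg_right (hf.dist_le_mul x y) (norm_nonneg a)

theorem lipschitzWith_act (U : Mat3) : ∃ K : ℝ≥0, LipschitzWith K (act U) :=
  ⟨_, (LinearMap.toContinuousLinearMap (Matrix.toEuclideanLin U)).lipschitz⟩

/-- The constant does not depend on the profile `w`, so it serves the whole generating sequence. -/
theorem exists_lipschitzWith_layered (U : Mat3) (a b : E3) (μ : ℝ) {p q : E3 → ℝ} {K L : ℝ≥0}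
    (hp : LipschitzWith K p) (hq : LipschitzWith L q) :
    ∃ M : ℝ≥0, ∀ w : ℝ → ℝ, LipschitzWith 1 w → LipschitzWith M (layered U a b μ p q w) := by
  obtain ⟨N, hN⟩ := lipschitzWith_act U
  exact ⟨_, fun w hw => ((hN.add (lipschitzWith_smul_const (hp.min_const 0) (μ • a))).sub
    (lipschitzWith_smul_const (hq.min_const 0) b)).add (lipschitzWith_smul_const
      ((hw.comp hp).min (hq.max_const 0)) a)⟩

theorem act_add_left (A B : Mat3) (x : E3) : act (A + B) x = act A x + act B x := by
  simp [act]

theorem act_sub_left (A B : Mat3) (x : E3) : act (A - B) x = act A x - act B x := by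
  simp [act]

theorem act_smul_left (c : ℝ) (A : Mat3) (x : E3) : act (c • A) x = c • act A x := by
  simp [act]

theorem act_tensor (a n x : E3) : act (tensor a n) x = inner ℝ n x • a := by
  ext i
  simp [act_apply, tensor, PiLp.inner_apply, Fin.sum_univ_three]
  ring

theorem hasFDerivAt_of_eventually_affine {f : E3 → E3} {x : E3} {M : Mat3}
    (h : ∃ w : E3, ∀ᶠ x' in 𝓝 x, f x' = act M x' + w) :
    HasFDerivAt f (LinearMap.toContinuousLinearMap (Matrix.toEuclideanLin M)) x := by
  obtain ⟨w, hw⟩ := h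
  have : HasFDerivAt (fun x' => act M x' + w)
      (LinearMap.toContinuousLinearMap (Matrix.toEuclideanLin M)) x :=
    (LinearMap.toContinuousLinearMap (Matrix.toEuclideanLin M)).hasFDerivAt.add_const w
  exact this.congr_of_eventuallyEq hw

theorem grad_of_eventually_affine {f : E3 → E3} {x : E3} {M : Mat3}
    (h : ∃ w : E3, ∀ᶠ x' in 𝓝 x, f x' = act M x' + w) : grad f x = M := by
  ext i j
  simp [grad, (hasFDerivAt_of_eventually_affine h).fderiv, Matrix.toLpLin_apply]

section LocalForm

variable {U : Mat3} {a b n m v : E3} {μ c₁ c₂ : ℝ} {p q : E3 → ℝ} {w : ℝ → ℝ} {x : E3}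

theorem layered_affine_of_neg (hp : ∀ x, p x = inner ℝ n (x - v) - c₂)
    (hq : ∀ x, q x = inner ℝ m (x - v) - c₁) (hw : ∀ t, 0 ≤ w t) (hpx : p x < 0) (hqx : q x < 0) :
    ∃ d : E3, ∀ᶠ x' in 𝓝 x, layered U a b μ p q w x' =
      act (U + μ • tensor a n - tensor b m) x' + d := by
  have hpc : Continuous p := by rw [funext hp]; fun_prop
  have hqc : Continuous q := by rw [funext hq]; fun_prop
  refine ⟨(-(inner ℝ n v) - c₂) • μ • a - (-(inner ℝ m v) - c₁) • b, ?_⟩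
  filter_upwards [hpc.continuousAt.eventually_lt continuousAt_const hpx,
    hqc.continuousAt.eventually_lt continuousAt_const hqx] with y hy hy'
  rw [layered, min_eq_left hy.le, min_eq_left hy'.le, max_eq_right hy'.le, min_eq_right (hw _), hp,
    hq, act_sub_left, act_add_left, act_smul_left, act_tensor, act_tensor, inner_sub_right,
    inner_sub_right]
  module

theorem layered_affine_of_pos (hp : ∀ x, p x = inner ℝ n (x - v) - c₂)
    (hq : ∀ x, q x = inner ℝ m (x - v) - c₁) (hw : ∀ t, 0 ≤ t → w t = 0) (hpx : 0 < p x)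
    (hqx : 0 < q x) :
    ∃ d : E3, ∀ᶠ x' in 𝓝 x, layered U a b μ p q w x' = act U x' + d := by
  have hpc : Continuous p := by rw [funext hp]; fun_prop
  have hqc : Continuous q := by rw [funext hq]; fun_prop
  refine ⟨0, ?_⟩
  filter_upwards [continuousAt_const.eventually_lt hpc.continuousAt hpx,
    continuousAt_const.eventually_lt hqc.continuousAt hqx] with y hy hy'
  rw [layered, min_eq_right hy.le, min_eq_right hy'.le, hw _ hy.le, max_eq_left hy'.le,
    min_eq_left hy'.le]
  module

theorem layered_affine_of_neg_pos (hp : ∀ x, p x = inner ℝ n (x - v) - c₂)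
    (hq : ∀ x, q x = inner ℝ m (x - v) - c₁) {σ : ℝ} (hwc : Continuous w)
    (hw : ∀ᶠ t in 𝓝 (p x), w t = w (p x) + σ * (t - p x)) (hpx : p x < 0)
    (hqx : 0 < q x) (hwq : w (p x) < q x) :
    ∃ d : E3, ∀ᶠ x' in 𝓝 x, layered U a b μ p q w x' = act (U + (μ + σ) • tensor a n) x' + d := by
  have hpc : Continuous p := by rw [funext hp]; fun_prop
  have hqc : Continuous q := by rw [funext hq]; fun_prop
  refine ⟨(-(inner ℝ n v) - c₂) • μ • a + (w (p x) + σ * (-(inner ℝ n v) - c₂ - p x)) • a, ?_⟩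
  filter_upwards [hpc.continuousAt.eventually_lt continuousAt_const hpx,
    continuousAt_const.eventually_lt hqc.continuousAt hqx, hpc.continuousAt.eventually hw,
    (hwc.comp hpc).continuousAt.eventually_lt hqc.continuousAt hwq] with y hy hy' hyw hyq
  rw [layered, min_eq_left hy.le, min_eq_right hy'.le, max_eq_left hy'.le,
    min_eq_left (show w (p y) ≤ q y from le_of_lt hyq), hyw, hp y, act_add_left, act_smul_left, act_tensor,
    inner_sub_right]
  module

end LocalForm

/-! ### The Young measure of an austenite nucleus -/

theorem ae_inner_sub_ne {n : E3} (hn : n ≠ 0) (v : E3) (c : ℝ) :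
    ∀ᵐ x : E3, inner ℝ n (x - v) ≠ c := by
  obtain ⟨x₀, hx₀⟩ : ∃ x₀ : E3, inner ℝ n (x₀ - v) = c := by
    refine ⟨v + (c / ‖n‖ ^ 2) • n, ?_⟩
    rw [add_sub_cancel_left, real_inner_smul_right, real_inner_self_eq_norm_sq]
    field_simp
  have hker : (innerₛₗ ℝ n).ker ≠ ⊤ := fun h => by
    have : n ∈ (innerₛₗ ℝ n).ker := h ▸ Submodule.mem_top
    simp at this
    exact hn this
  have h0 := Measure.addHaar_submodule (volume : Measure E3) _ hker
  rw [← measure_preimage_add_right volume (-x₀)] at h0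
  refine measure_mono_null (fun x hx => ?_) h0
  simp only [mem_compl_iff, mem_ofPred_eq, not_not] at hx
  simp only [mem_preimage, SetLike.mem_coe, LinearMap.mem_ker, innerₛₗ_apply_apply]
  rw [← sub_eq_add_neg, ← sub_sub_sub_cancel_right x x₀ v, inner_sub_right, hx, hx₀, sub_self]

/-- For all `k` together the kinks lie on countably many planes. -/
theorem ae_fract_inner_ne {n : E3} (hn : n ≠ 0) (v : E3) (c s : ℝ) :
    ∀ᵐ x : E3, ∀ k : ℕ, Int.fract ((k + 1) * (inner ℝ n (x - v) - c)) ≠ s := by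
  have h : ∀ᵐ x : E3, ∀ k : ℕ, ∀ j : ℤ, inner ℝ n (x - v) ≠ (j + s) / (k + 1) + c :=
    ae_all_iff.2 fun k => ae_all_iff.2 fun j => ae_inner_sub_ne hn v _
  filter_upwards [h] with x hx k hk
  refine hx k ⌊(k + 1 : ℝ) * (inner ℝ n (x - v) - c)⌋ ?_
  rw [← hk, Int.floor_add_fract]
  field_simp
  ring

theorem measurableSet_inner_sub_lt (n v : E3) (c : ℝ) :
    MeasurableSet {x : E3 | inner ℝ n (x - v) < c} :=
  (isOpen_Iio.preimage (by fun_prop : Continuous fun x : E3 => inner ℝ n (x - v))).measurableSet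

/-- The simple laminate of `F` and `G` with volume fractions `lam` and `1 - lam`. -/
def laminate (lam : ℝ) (F G : Mat3) : Measure Mat3 :=
  ENNReal.ofReal lam • Measure.dirac F + ENNReal.ofReal (1 - lam) • Measure.dirac G

open Classical in
/-- The Young measure equal to `δ_R` on the side `m · (x - v) < c₁`, then to a laminate of `F` and
`G` up to the plane `n · (x - v) = c₂`, and to `δ_F` beyond. -/
def nucleusKernel (R F G : Mat3) (lam : ℝ) (m n v : E3) (c₁ c₂ : ℝ) : Kernel E3 Mat3 :=
  Kernel.piecewise (measurableSet_inner_sub_lt m v c₁) (Kernel.const E3 (Measure.dirac R))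
    (Kernel.piecewise (measurableSet_inner_sub_lt n v c₂) (Kernel.const E3 (laminate lam F G))
      (Kernel.const E3 (Measure.dirac F)))

theorem nucleusKernel_apply (R F G : Mat3) (lam : ℝ) (m n v : E3) (c₁ c₂ : ℝ) (x : E3) :
    nucleusKernel R F G lam m n v c₁ c₂ x =
      if inner ℝ m (x - v) < c₁ then Measure.dirac R
      else if inner ℝ n (x - v) < c₂ then laminate lam F G else Measure.dirac F := by
  simp only [nucleusKernel, Kernel.piecewise_apply, Kernel.const_apply, mem_ofPred_eq]

theorem isProbabilityMeasure_laminate {lam : ℝ} (h : lam ∈ Ioo (0 : ℝ) 1) (F G : Mat3) :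
    IsProbabilityMeasure (laminate lam F G) := by
  constructor
  simp only [laminate, Measure.add_apply, Measure.smul_apply, measure_univ, smul_eq_mul, mul_one]
  rw [← ENNReal.ofReal_add h.1.le (sub_nonneg.2 h.2.le), add_sub_cancel, ENNReal.ofReal_one]

theorem isMarkovKernel_nucleusKernel {lam : ℝ} (h : lam ∈ Ioo (0 : ℝ) 1) (R F G : Mat3)
    (m n v : E3) (c₁ c₂ : ℝ) : IsMarkovKernel (nucleusKernel R F G lam m n v c₁ c₂) := by
  have := isProbabilityMeasure_laminate h F G
  refine ⟨fun x => ?_⟩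
  rw [nucleusKernel_apply]
  split_ifs <;> infer_instance

theorem integral_laminate {lam : ℝ} (h : lam ∈ Ioo (0 : ℝ) 1) (F G : Mat3) (f : Mat3 → ℝ) :
    ∫ A, f A ∂(laminate lam F G) = lam * f F + (1 - lam) * f G := by
  rw [laminate, integral_add_measure, integral_smul_measure, integral_smul_measure, integral_dirac,
    integral_dirac, ENNReal.toReal_ofReal h.1.le, ENNReal.toReal_ofReal (sub_nonneg.2 h.2.le),
    smul_eq_mul, smul_eq_mul]
  · exact (integrable_dirac (by simp)).smul_measure ENNReal.ofReal_ne_top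
  · exact (integrable_dirac (by simp)).smul_measure ENNReal.ofReal_ne_top

theorem measurable_comp_grad {f : Mat3 → ℝ} (hf : Continuous f) (z : E3 → E3) :
    Measurable fun x => f (grad z x) := by
  have hL : Continuous fun T : E3 →L[ℝ] E3 =>
      (Matrix.of fun i j => T (EuclideanSpace.single j 1) i : Mat3) := by
    refine continuous_matrix fun i j => ?_
    simp only [Matrix.of_apply]
    fun_prop
  exact (hf.comp hL).measurable.comp (measurable_fderiv ℝ z)

/-- The oscillation has amplitude at most `1/K`, so truncation by `max q 0`, which glues the
laminate continuously to the austenite, acts only in the layer `0 < q ≤ 1/K`; `hqK` excludes that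
layer. -/
theorem grad_layered_sawtooth {U : Mat3} {a b n m v : E3} {μ c₁ c₂ K : ℝ} {p q : E3 → ℝ}
    (h0 : 0 ≤ μ) (h1 : μ ≤ 1) (hK : 0 < K)
    (hp : ∀ x, p x = inner ℝ n (x - v) - c₂) (hq : ∀ x, q x = inner ℝ m (x - v) - c₁)
    {x : E3} (hpx : p x ≠ 0) (hqx : q x ≠ 0) (hpq : q x < 0 → p x < 0) (hqK : 0 < q x → 1 / K < q x)
    (hf0 : Int.fract (K * p x) ≠ 0) (hfμ : Int.fract (K * p x) ≠ μ) :
    grad (layered U a b μ p q (sawtoothCut μ K)) x =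
      if q x < 0 then U + μ • tensor a n - tensor b m
      else if p x < 0 then U + phase μ (K * p x) • tensor a n else U := by
  rcases lt_or_gt_of_ne hqx with hq0 | hq0
  · rw [if_pos hq0]
    exact grad_of_eventually_affine
      (layered_affine_of_neg hp hq (sawtoothCut_nonneg h0 h1 hK) (hpq hq0) hq0)
  · rw [if_neg hq0.not_gt]
    rcases lt_or_gt_of_ne hpx with hp0 | hp0
    · rw [if_pos hp0, ← add_sub_cancel μ (phase μ (K * p x))]
      exact grad_of_eventually_affine (layered_affine_of_neg_pos hp hq
        (lipschitzWith_sawtoothCut h0 h1 hK).continuous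
        (eventually_sawtoothCut_eq hK hp0 hf0 hfμ) hp0 hq0
        ((sawtoothCut_le h0 hK _).trans_lt (hqK hq0)))
    · rw [if_neg hp0.not_gt]
      exact grad_of_eventually_affine (layered_affine_of_pos hp hq
        (fun t => sawtoothCut_of_nonneg h0) hp0 hq0)

theorem integral_nucleusKernel {lam : ℝ} (h : lam ∈ Ioo (0 : ℝ) 1) (R F G : Mat3)
    (m n v : E3) (c₁ c₂ : ℝ) (f : Mat3 → ℝ) (x : E3) :
    ∫ A, f A ∂(nucleusKernel R F G lam m n v c₁ c₂ x) =
      if inner ℝ m (x - v) < c₁ then f R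
      else if inner ℝ n (x - v) < c₂ then lam * f F + (1 - lam) * f G else f F := by
  rw [nucleusKernel_apply]
  split_ifs
  · exact integral_dirac _ _
  · exact integral_laminate h F G f
  · exact integral_dirac _ _

theorem lipschitzWith_level {f : E3 → ℝ} {w v : E3} {c : ℝ} (hf : ∀ x, f x = inner ℝ w (x - v) - c) :
    LipschitzWith ‖w‖₊ f := LipschitzWith.of_dist_le_mul fun x y => by
  rw [hf, hf, Real.dist_eq, sub_sub_sub_cancel_right, ← inner_sub_right,
    sub_sub_sub_cancel_right, coe_nnnorm, dist_eq_norm]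
  exact abs_real_inner_le_norm _ _

/-- Off null sets, `g f(∇z_k)` equals `g I + h · phase` once `k` is so large that `x` has left the
transition layer. Here `I` records the values of `f` with the oscillation off, and `h` is the jump
between the twins. Dominated convergence removes the discrepancy, and the phase converges weakly to
its mean `μ`. -/
theorem isGradientYoungMeasure_nucleusKernel {Ω : Set E3} (hΩ : MeasurableSet Ω) {U R V : Mat3}
    {a b n m v : E3} {lam c₁ c₂ : ℝ} (hlam : lam ∈ Ioo (0 : ℝ) 1) (hn : n ≠ 0) (hm : m ≠ 0)
    (hV : V = U + tensor a n) (hR : R = U + (1 - lam) • tensor a n - tensor b m)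
    (hcut : ∀ x ∈ Ω, inner ℝ m (x - v) ≤ c₁ → inner ℝ n (x - v) < c₂) :
    IsGradientYoungMeasure Ω (nucleusKernel R U V lam m n v c₁ c₂) := by
  refine ⟨isMarkovKernel_nucleusKernel hlam R U V m n v c₁ c₂, ?_⟩
  obtain ⟨μ, hμ⟩ : ∃ μ, μ = 1 - lam := ⟨_, rfl⟩
  have h0 : 0 ≤ μ := by linarith [hlam.2]
  have h1 : μ ≤ 1 := by linarith [hlam.1]
  obtain ⟨p, hp⟩ : ∃ p : E3 → ℝ, ∀ x, p x = inner ℝ n (x - v) - c₂ := ⟨_, fun _ => rfl⟩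
  obtain ⟨q, hq⟩ : ∃ q : E3 → ℝ, ∀ x, q x = inner ℝ m (x - v) - c₁ := ⟨_, fun _ => rfl⟩
  have hpL := lipschitzWith_level hp
  have hqL := lipschitzWith_level hq
  obtain ⟨M, hM⟩ := exists_lipschitzWith_layered U a b μ hpL hqL
  have hK : ∀ k : ℕ, (0 : ℝ) < k + 1 := fun k => by positivity
  refine ⟨fun k => layered U a b μ p q (sawtoothCut μ (k + 1)), M,
    fun k => (hM _ (lipschitzWith_sawtoothCut h0 h1 (hK k))).lipschitzOnWith, fun f hf hfc g hg => ?_⟩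
  obtain ⟨C, hC⟩ := hfc.exists_bound_of_continuous hf
  have hpm : MeasurableSet {x | p x < 0} := measurableSet_lt hpL.continuous.measurable measurable_const
  have hqm : MeasurableSet {x | q x < 0} := measurableSet_lt hqL.continuous.measurable measurable_const
  classical
  obtain ⟨I, hI⟩ : ∃ I : E3 → ℝ, ∀ x, I x = if q x < 0 then f R else f U := ⟨_, fun _ => rfl⟩
  have hIm : Measurable I := by
    rw [funext hI]; exact Measurable.ite hqm measurable_const measurable_const
  have hIC : ∀ x, ‖I x‖ ≤ C := fun x => by rw [hI]; split_ifs <;> exact hC _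
  obtain ⟨S, hS⟩ : ∃ S : Set E3, S = {x | q x < 0}ᶜ ∩ {x | p x < 0} := ⟨_, rfl⟩
  have hSm : MeasurableSet S := hS ▸ hqm.compl.inter hpm
  obtain ⟨h, hh⟩ : ∃ h : E3 → ℝ, h = S.indicator fun x => g x * (f V - f U) := ⟨_, rfl⟩
  have hgI : IntegrableOn (fun x => g x * I x) Ω :=
    hg.mul_bdd (c := C) hIm.aestronglyMeasurable (Eventually.of_forall hIC)
  have hhi : IntegrableOn h Ω := hh ▸ (hg.mul_const _).indicator hSm
  have hχm : ∀ k : ℕ, Measurable fun x => phase μ ((k + 1) * p x) := fun k =>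
    (measurable_phase μ).comp (hpL.continuous.measurable.const_mul _)
  have hhχ : ∀ k : ℕ, IntegrableOn (fun x => h x * phase μ ((k + 1) * p x)) Ω := fun k =>
    hhi.mul_bdd (c := 1) (hχm k).aestronglyMeasurable (Eventually.of_forall fun x => abs_phase_le_one _ _)
  have hgf : ∀ k : ℕ, IntegrableOn
      (fun x => g x * f (grad (layered U a b μ p q (sawtoothCut μ (k + 1))) x)) Ω := fun k =>
    hg.mul_bdd (c := C) (measurable_comp_grad hf _).aestronglyMeasurable
      (Eventually.of_forall fun x => hC _)
  have T1 : Tendsto (fun k : ℕ => ∫ x in Ω,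
      (g x * f (grad (layered U a b μ p q (sawtoothCut μ (k + 1))) x) - g x * I x -
        h x * phase μ ((k + 1) * p x))) atTop (𝓝 (∫ x in Ω, (0 : ℝ))) := by
    refine tendsto_integral_of_dominated_convergence (fun x => ‖g x‖ * C + ‖g x * I x‖ + ‖h x‖)
      (fun k => (((hgf k).sub hgI).sub (hhχ k)).aestronglyMeasurable)
      (((hg.norm.mul_const C).add hgI.norm).add hhi.norm) (fun k => Eventually.of_forall fun x => ?_) ?_
    · refine (norm_sub_le _ _).trans (add_le_add ((norm_sub_le _ _).trans (add_le_add ?_ le_rfl)) ?_)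
      · rw [norm_mul]; exact mul_le_mul_of_nonneg_left (hC _) (norm_nonneg _)
      · rw [norm_mul]; exact mul_le_of_le_one_right (norm_nonneg _) (abs_phase_le_one _ _)
    · filter_upwards [ae_restrict_mem hΩ, ae_restrict_of_ae (ae_inner_sub_ne hn v c₂),
        ae_restrict_of_ae (ae_inner_sub_ne hm v c₁), ae_restrict_of_ae (ae_fract_inner_ne hn v c₂ 0),
        ae_restrict_of_ae (ae_fract_inner_ne hn v c₂ μ)] with x hxΩ hxp hxq hx0 hxμ
      have hpx : p x ≠ 0 := by rw [hp]; exact sub_ne_zero.2 hxp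
      have hqx : q x ≠ 0 := by rw [hq]; exact sub_ne_zero.2 hxq
      have hpq : q x < 0 → p x < 0 := fun h => by
        have := hcut x hxΩ (by rw [hq] at h; linarith)
        rw [hp]; linarith
      have hev : ∀ᶠ k : ℕ in atTop, 0 < q x → 1 / ((k : ℝ) + 1) < q x := by
        by_cases h : 0 < q x
        · exact (tendsto_one_div_add_atTop_nhds_zero_nat.eventually_lt_const h).mono fun _ h' _ => h'
        · exact Eventually.of_forall fun _ h' => absurd h' h
      refine tendsto_const_nhds.congr' ?_
      filter_upwards [hev] with k hk
      rw [grad_layered_sawtooth h0 h1 (hK k) hp hq hpx hqx hpq hk (by rw [hp]; exact hx0 k)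
        (by rw [hp]; exact hxμ k), hI, hh, hμ, ← hR]
      by_cases hq0 : q x < 0
      · rw [if_pos hq0, if_pos hq0, indicator_of_notMem (by simp [hS, hq0])]
        ring
      · rw [if_neg hq0, if_neg hq0]
        by_cases hp0 : p x < 0
        · rw [if_pos hp0, indicator_of_mem (by rw [hS]; exact ⟨hq0, hp0⟩), phase]
          split_ifs
          · rw [one_smul, ← hV]; ring
          · rw [zero_smul, add_zero]; ring
        · rw [if_neg hp0, indicator_of_notMem (by simp [hS, hp0])]
          ring
  have T2 : Tendsto (fun k : ℕ => ∫ x in Ω, h x * phase μ ((k + 1) * p x)) atTop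
      (𝓝 (∫ x in Ω, h x * μ)) := by
    have := tendsto_integral_mul_periodic (hhi.integrable_indicator hΩ) (measurable_phase μ)
      (periodic_phase μ) (abs_phase_le_one μ) hn hpL.continuous.measurable (fun x y => by
        rw [hp, hp, add_sub_assoc, inner_add_right, add_sub_assoc])
    rw [integral_phase h0 h1] at this
    have e : ∀ u : E3 → ℝ, ∫ x, Ω.indicator h x * u x = ∫ x in Ω, h x * u x := fun u => by
      rw [← integral_indicator hΩ]
      congr 1
      ext x
      by_cases hx : x ∈ Ω <;> simp [hx]
    simpa only [e] using this
  have T := (T1.add_const (∫ x in Ω, g x * I x)).add T2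
  rw [integral_zero, zero_add, ← integral_add hgI (hhi.mul_const μ)] at T
  refine Tendsto.congr (fun k => ?_) (T.trans_eq ?_)
  · have hk : IntegrableOn (fun x => g x * f (grad (layered U a b μ p q (sawtoothCut μ (k + 1))) x)
        - g x * I x) Ω := (hgf k).sub hgI
    rw [integral_sub hk (hhχ k), integral_sub (hgf k) hgI]
    ring
  · congr 1
    refine integral_congr_ae (Eventually.of_forall fun x => ?_)
    simp only
    rw [integral_nucleusKernel hlam, hI, hh]
    have e1 : inner ℝ m (x - v) < c₁ ↔ q x < 0 := by rw [hq, sub_neg]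
    have e2 : inner ℝ n (x - v) < c₂ ↔ p x < 0 := by rw [hp, sub_neg]
    simp only [e1, e2]
    by_cases hq0 : q x < 0
    · rw [if_pos hq0, if_pos hq0, indicator_of_notMem (by simp [hS, hq0])]
      ring
    · rw [if_neg hq0, if_neg hq0]
      by_cases hp0 : p x < 0
      · rw [if_pos hp0, indicator_of_mem (by rw [hS]; exact ⟨hq0, hp0⟩), hμ]
        ring
      · rw [if_neg hp0, indicator_of_notMem (by simp [hS, hp0])]
        ring

/-! ### Admissibility -/

theorem det_grad (y : E3 → E3) (x : E3) : (grad y x).det = (fderiv ℝ y x).det := by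
  have : grad y x = LinearMap.toMatrix (EuclideanSpace.basisFun (Fin 3) ℝ).toBasis
      (EuclideanSpace.basisFun (Fin 3) ℝ).toBasis (fderiv ℝ y x : E3 →ₗ[ℝ] E3) := by
    ext i j
    simp [grad, LinearMap.toMatrix_apply]
  rw [this, LinearMap.det_toMatrix]

/-- The Ciarlet–Nečas condition for an injective map that is differentiable almost everywhere. -/
theorem ofReal_integral_det_grad_le {Ω N : Set E3} (hΩ : MeasurableSet Ω) (hN : MeasurableSet N)
    (hN0 : volume N = 0) {y : E3 → E3} (hy : ∀ x ∈ Ω \ N, DifferentiableAt ℝ y x)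
    (hinj : InjOn y Ω) :
    ENNReal.ofReal (∫ x in Ω, (grad y x).det) ≤ volume (y '' Ω) := by
  calc ENNReal.ofReal (∫ x in Ω, (grad y x).det)
      ≤ ENNReal.ofReal ‖∫ x in Ω, (grad y x).det‖ := ENNReal.ofReal_le_ofReal (le_abs_self _)
    _ = ‖∫ x in Ω, (grad y x).det‖ₑ := ofReal_norm _
    _ ≤ ∫⁻ x in Ω, ‖(grad y x).det‖ₑ := enorm_integral_le_lintegral_enorm _
    _ = ∫⁻ x in Ω \ N, ENNReal.ofReal |(fderiv ℝ y x).det| := by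
        rw [Measure.restrict_congr_set (sdiff_null_ae_eq_self hN0)]
        refine lintegral_congr fun x => ?_
        rw [det_grad, ← ofReal_norm, Real.norm_eq_abs]
    _ = volume (y '' (Ω \ N)) :=
        lintegral_abs_det_fderiv_eq_addHaar_image volume (hΩ.diff hN)
          (fun x hx => (hy x hx).hasFDerivAt.hasFDerivWithinAt) (hinj.mono sdiff_subset)
    _ ≤ volume (y '' Ω) := measure_mono (image_mono sdiff_subset)

theorem layered_zero_apply (U : Mat3) (a b : E3) (μ : ℝ) (p q : E3 → ℝ) (x : E3) :
    layered U a b μ p q (fun _ => 0) x = act U x + min (p x) 0 • μ • a - min (q x) 0 • b := by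
  rw [layered, min_eq_left (le_max_right _ _), zero_smul, add_zero]

/-- The rank-one corrections have Lipschitz constant below the lower bound `κ` of `U`, so they
cannot cancel `U (x - y)`. -/
theorem injective_layered_zero {U : Mat3} {a b : E3} {μ κ : ℝ} (hμ : 0 ≤ μ) {p q : E3 → ℝ}
    {K L : ℝ≥0} (hp : LipschitzWith K p) (hq : LipschitzWith L q)
    (hU : ∀ x, κ * ‖x‖ ≤ ‖act U x‖) (hsmall : μ * (‖a‖ * K) + ‖b‖ * L < κ) :
    Function.Injective (layered U a b μ p q fun _ => 0) := by
  intro x y hxy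
  rw [layered_zero_apply, layered_zero_apply] at hxy
  by_contra hne
  have hpos : 0 < ‖x - y‖ := norm_pos_iff.2 (sub_ne_zero.2 hne)
  have h1 : act U (x - y) = (min (q x) 0 - min (q y) 0) • b - (min (p x) 0 - min (p y) 0) • μ • a := by
    have : act U (x - y) = act U x - act U y := map_sub _ _ _
    rw [this, sub_smul, sub_smul]
    linear_combination (norm := module) hxy
  have h2 := (hp.min_const 0).dist_le_mul x y
  have h3 := (hq.min_const 0).dist_le_mul x y
  rw [Real.dist_eq, dist_eq_norm] at h2 h3
  have h4 : ‖act U (x - y)‖ ≤ (L * ‖x - y‖) * ‖b‖ + (K * ‖x - y‖) * (μ * ‖a‖) := by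
    rw [h1]
    refine (norm_sub_le _ _).trans (add_le_add ?_ ?_)
    · rw [norm_smul]; exact mul_le_mul_of_nonneg_right h3 (norm_nonneg _)
    · rw [norm_smul, norm_smul, Real.norm_of_nonneg hμ]
      exact mul_le_mul_of_nonneg_right h2 (by positivity)
  have h5 := (hU (x - y)).trans h4
  have h6 := mul_lt_mul_of_pos_right hsmall hpos
  linarith

theorem isAdmissible_nucleusKernel {Ω : Set E3} (hΩ : IsOpen Ω) {U R V : Mat3}
    {a b n m v : E3} {lam c₁ c₂ r κ : ℝ} (hlam : lam ∈ Ioo (0 : ℝ) 1) (hn : n ≠ 0) (hm : m ≠ 0)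
    (hV : V = U + tensor a n) (hR : R = U + (1 - lam) • tensor a n - tensor b m)
    (hcut : ∀ x ∈ Ω, inner ℝ m (x - v) ≤ c₁ → inner ℝ n (x - v) < c₂)
    (hball : ∀ x ∈ Ω, inner ℝ n (x - v) < c₂ → ‖x - v‖ < r)
    (hU : ∀ x, κ * ‖x‖ ≤ ‖act U x‖) (hsmall : (1 - lam) * (‖a‖ * ‖n‖) + ‖b‖ * ‖m‖ < κ) :
    IsAdmissible U Ω (Ω ∩ Metric.ball v r) (nucleusKernel R U V lam m n v c₁ c₂) := by
  have hout : ∀ x ∈ Ω, x ∉ Ω ∩ Metric.ball v r →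
      ¬ inner ℝ n (x - v) < c₂ ∧ ¬ inner ℝ m (x - v) ≤ c₁ := fun x hx hxB => by
    have h1 : ¬ inner ℝ n (x - v) < c₂ := fun h =>
      hxB ⟨hx, mem_ball_iff_norm.2 (hball x hx h)⟩
    exact ⟨h1, fun h => h1 (hcut x hx h)⟩
  refine ⟨isGradientYoungMeasure_nucleusKernel hΩ.measurableSet hlam hn hm hV hR hcut,
    fun x hx => ?_, ?_⟩
  · obtain ⟨h1, h2⟩ := hout x hx.1 hx.2
    rw [nucleusKernel_apply, if_neg fun h => h2 (le_of_lt h), if_neg h1]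
  obtain ⟨μ, hμ⟩ : ∃ μ, μ = 1 - lam := ⟨_, rfl⟩
  have h0 : 0 ≤ μ := by linarith [hlam.2]
  obtain ⟨p, hp⟩ : ∃ p : E3 → ℝ, ∀ x, p x = inner ℝ n (x - v) - c₂ := ⟨_, fun _ => rfl⟩
  obtain ⟨q, hq⟩ : ∃ q : E3 → ℝ, ∀ x, q x = inner ℝ m (x - v) - c₁ := ⟨_, fun _ => rfl⟩
  have hpL := lipschitzWith_level hp
  have hqL := lipschitzWith_level hq
  obtain ⟨M, hM⟩ := exists_lipschitzWith_layered U a b μ hpL hqL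
  obtain ⟨N, hN⟩ : ∃ N : Set E3, N = {x | inner ℝ n (x - v) = c₂} ∪ {x | inner ℝ m (x - v) = c₁} :=
    ⟨_, rfl⟩
  have hNmem : ∀ x, x ∉ N → p x ≠ 0 ∧ q x ≠ 0 := fun x hx => by
    rw [hN, mem_union, not_or] at hx
    rw [hp, hq]
    exact ⟨sub_ne_zero.2 hx.1, sub_ne_zero.2 hx.2⟩
  have hNmeas : MeasurableSet N := by
    rw [hN]
    exact (isClosed_eq (by fun_prop) continuous_const).measurableSet.union
      (isClosed_eq (by fun_prop) continuous_const).measurableSet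
  have hN0 : volume N = 0 := by
    rw [hN]
    refine measure_union_null ?_ ?_
    · simpa [ae_iff] using ae_inner_sub_ne hn v c₂
    · simpa [ae_iff] using ae_inner_sub_ne hm v c₁
  have haff : ∀ x ∈ Ω \ N, ∃ d : E3, ∀ᶠ x' in 𝓝 x, layered U a b μ p q (fun _ => 0) x' =
      act (if q x < 0 then U + μ • tensor a n - tensor b m
        else if p x < 0 then U + μ • tensor a n else U) x' + d := by
    intro x hx
    obtain ⟨hpx, hqx⟩ := hNmem x hx.2
    rcases lt_or_gt_of_ne hqx with hq0 | hq0
    · rw [if_pos hq0]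
      refine layered_affine_of_neg hp hq (fun _ => le_rfl) ?_ hq0
      have := hcut x hx.1 (by rw [hq] at hq0; linarith)
      rw [hp]; linarith
    · rw [if_neg hq0.not_gt]
      rcases lt_or_gt_of_ne hpx with hp0 | hp0
      · rw [if_pos hp0, ← add_zero μ]
        have := layered_affine_of_neg_pos (U := U) (a := a) (b := b) (μ := μ) hp hq (σ := 0)
          (w := fun _ => 0) continuous_const (by simp) hp0 hq0 hq0
        simpa only [add_zero] using this
      · rw [if_neg hp0.not_gt]
        exact layered_affine_of_pos hp hq (fun _ _ => rfl) hp0 hq0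
  refine ⟨layered U a b μ p q fun _ => 0, M, (hM _ (LipschitzWith.const' 0)).lipschitzOnWith,
    ?_, fun x hx => ?_, ?_⟩
  · filter_upwards [ae_restrict_mem hΩ.measurableSet, ae_restrict_of_ae (measure_eq_zero_iff_ae_notMem.1 hN0)]
      with x hxΩ hxN
    rw [grad_of_eventually_affine (haff x ⟨hxΩ, hxN⟩)]
    have e1 : inner ℝ m (x - v) < c₁ ↔ q x < 0 := by rw [hq, sub_neg]
    have e2 : inner ℝ n (x - v) < c₂ ↔ p x < 0 := by rw [hp, sub_neg]
    ext i j
    rw [barycenter, Matrix.of_apply, integral_nucleusKernel hlam _ _ _ _ _ _ _ _ fun A => A i j]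
    simp only [e1, e2]
    split_ifs
    · rw [hR, hμ]
    · rw [hV, hμ]
      simp
      ring
    · rfl
  -- The localization set is open and so misses its frontier; outside it both corrections vanish.
  · have hxB : x ∉ Ω ∩ Metric.ball v r := fun h =>
      (hΩ.inter Metric.isOpen_ball).inter_frontier_eq.subset ⟨h, hx.1⟩
    obtain ⟨h1, h2⟩ := hout x hx.2 hxB
    rw [layered_zero_apply, min_eq_right (by rw [hp]; linarith), min_eq_right (by rw [hq]; linarith)]
    simp
  · exact ofReal_integral_det_grad_le hΩ.measurableSet hNmeas hN0
      (fun x hx => (hasFDerivAt_of_eventually_affine (haff x hx)).differentiableAt)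
      (injective_layered_zero h0 hpL hqL hU (by rw [hμ]; exact hsmall)).injOn

/-! ### Energy -/

theorem energyDensity_of_mem_SO3 {α β γ δ : ℝ} {A : Mat3} (h : A ∈ SO3) :
    energyDensity α β γ δ A = ((-δ : ℝ) : EReal) := if_pos h

theorem energyDensity_of_well {α β γ δ : ℝ} {A Q : Mat3} (hA : A ∉ SO3) (hQ : Q ∈ SO3) {l : Fin 6}
    (h : A = Q * variant α β γ l) : energyDensity α β γ δ A = 0 := by
  rw [energyDensity, if_neg hA, if_pos ⟨l, Q, hQ, h⟩]

theorem extIntegral_dirac (A : Mat3) (W : Mat3 → EReal) :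
    extIntegral (Measure.dirac A) W = ((W A).toENNReal : EReal) - ((-(W A)).toENNReal : EReal) := by
  rw [extIntegral, lintegral_dirac, lintegral_dirac]

theorem extIntegral_laminate_eq_zero {lam : ℝ} {F G : Mat3} {W : Mat3 → EReal} (hF : W F = 0)
    (hG : W G = 0) : extIntegral (laminate lam F G) W = 0 := by
  simp [extIntegral, laminate, lintegral_add_measure, lintegral_smul_measure, lintegral_dirac, hF, hG]

theorem energy_pureKernel {α β γ δ : ℝ} (Ω : Set E3) {U : Mat3}
    (hU : energyDensity α β γ δ U = 0) : energy α β γ δ Ω (pureKernel U) = 0 := by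
  simp [energy, pureKernel, hU, extIntegral]

/-- Martensite contributes zero, so the energy is `-δ` times the volume of the austenite region. -/
theorem energy_nucleusKernel_neg {α β γ δ : ℝ} (hδ : 0 < δ) {Ω : Set E3}
    {U R V : Mat3} {lam : ℝ} {m n v : E3} {c₁ c₂ : ℝ} (hR : R ∈ SO3)
    (hU : energyDensity α β γ δ U = 0) (hV : energyDensity α β γ δ V = 0)
    (hpos : 0 < volume (Ω ∩ {x | inner ℝ m (x - v) < c₁})) :
    energy α β γ δ Ω (nucleusKernel R U V lam m n v c₁ c₂) < 0 := by
  have h : ∀ x, extIntegral (nucleusKernel R U V lam m n v c₁ c₂ x) (energyDensity α β γ δ) =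
      if inner ℝ m (x - v) < c₁ then ((-δ : ℝ) : EReal) else 0 := fun x => by
    rw [nucleusKernel_apply]
    split_ifs
    · rw [extIntegral_dirac, energyDensity_of_mem_SO3 hR]
      rw [← EReal.coe_neg, neg_neg, EReal.toENNReal_of_nonpos (by exact_mod_cast (neg_neg_of_pos hδ).le)]
      simp [EReal.toENNReal_of_ne_top, hδ.le]
    · exact extIntegral_laminate_eq_zero hU hV
    · rw [extIntegral_dirac, hU]; simp
  rw [energy]
  simp_rw [h]
  have e1 : ∀ x, (if inner ℝ m (x - v) < c₁ then ((-δ : ℝ) : EReal) else 0).toENNReal = 0 := fun x => by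
    refine EReal.toENNReal_of_nonpos ?_
    split_ifs
    · exact_mod_cast (neg_neg_of_pos hδ).le
    · exact le_rfl
  have e2 : ∀ x, (-(if inner ℝ m (x - v) < c₁ then ((-δ : ℝ) : EReal) else 0)).toENNReal =
      {x | inner ℝ m (x - v) < c₁}.indicator (fun _ => ENNReal.ofReal δ) x := fun x => by
    by_cases hx : inner ℝ m (x - v) < c₁
    · rw [if_pos hx, indicator_of_mem (by exact hx), ← EReal.coe_neg, neg_neg]
      simp [EReal.toENNReal_of_ne_top]
    · rw [if_neg hx, indicator_of_notMem (by exact hx)]; simp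
  rw [extIntegral]
  simp_rw [e1, e2]
  rw [lintegral_zero, lintegral_indicator (measurableSet_inner_sub_lt m v c₁), lintegral_const,
    Measure.restrict_restrict (measurableSet_inner_sub_lt m v c₁), Measure.restrict_apply_univ,
    inter_comm, EReal.coe_ennreal_zero, zero_sub, EReal.neg_lt_zero]
  exact_mod_cast ENNReal.mul_pos (ENNReal.ofReal_pos.2 hδ).ne' hpos.ne'

/-! ### Nucleation at a corner -/

/-- One principal axis is stretched by `β ≠ 1`. Hence the density on the martensitic wells is `0`
and not `-δ`. -/
theorem variant_notMem_SO3 {α β γ : ℝ} (h : IsCuAlNiLattice α β γ) (l : Fin 6) :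
    variant α β γ l ∉ SO3 := by
  intro hl
  have hβ : β * β ≠ 1 := by nlinarith [h.beta_mem.1, h.beta_mem.2]
  have key : ∀ k : Fin 3, ((variant α β γ l).transpose * variant α β γ l) k k = 1 := fun k => by
    rw [hl.1]; simp
  fin_cases l
  · exact hβ (by simpa [variant, Matrix.mul_apply, Fin.sum_univ_three] using key 0)
  · exact hβ (by simpa [variant, Matrix.mul_apply, Fin.sum_univ_three] using key 0)
  · exact hβ (by simpa [variant, Matrix.mul_apply, Fin.sum_univ_three] using key 1)
  · exact hβ (by simpa [variant, Matrix.mul_apply, Fin.sum_univ_three] using key 1)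
  · exact hβ (by simpa [variant, Matrix.mul_apply, Fin.sum_univ_three] using key 2)
  · exact hβ (by simpa [variant, Matrix.mul_apply, Fin.sum_univ_three] using key 2)

theorem mem_SO3_of_mul_mem {Q A : Mat3} (hQ : Q ∈ SO3) (h : Q * A ∈ SO3) : A ∈ SO3 := by
  have h1 := h.1
  have h2 := h.2
  rw [Matrix.transpose_mul, Matrix.mul_assoc, ← Matrix.mul_assoc Q.transpose, hQ.1,
    Matrix.one_mul] at h1
  rw [Matrix.det_mul, hQ.2, one_mul] at h2
  exact ⟨h1, h2⟩

theorem one_mem_SO3 : (1 : Mat3) ∈ SO3 := by constructor <;> simp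

theorem energyDensity_rotated_variant {α β γ δ : ℝ} (h : IsCuAlNiLattice α β γ) {Q : Mat3}
    (hQ : Q ∈ SO3) (l : Fin 6) : energyDensity α β γ δ (Q * variant α β γ l) = 0 :=
  energyDensity_of_well (fun hl => variant_notMem_SO3 h l (mem_SO3_of_mul_mem hQ hl)) hQ rfl

/-- The tensors are even in the pair of vectors; reversing the normals serves the opposite corner.
-/
theorem IsNucleusData.neg {α β γ : ℝ} {s l : Fin 6} {R Q : Mat3} {lam : ℝ} {a n b m : E3}
    (h : IsNucleusData α β γ s R Q l lam a n b m) :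
    IsNucleusData α β γ s R Q l lam (-a) (-n) (-b) (-m) := by
  have ht : ∀ x y : E3, tensor (-x) (-y) = tensor x y := fun x y => by
    ext i j; simp [tensor]
  refine ⟨h.R_mem, h.Q_mem, h.lam_mem, neg_ne_zero.2 h.a_ne, neg_ne_zero.2 h.b_ne, ?_,
    by rw [ht]; exact h.twin, by rw [ht]; exact h.habit, fun i => by simpa using h.sign i,
    by simpa only [norm_neg] using h.small, h.bound⟩
  have := h.indep
  rw [LinearIndependent.pair_iff] at this ⊢
  intro x y hxy
  refine this x y (neg_eq_zero.1 ?_)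
  rw [← hxy]
  module

theorem IsNucleusData.exists_nucleus {α β γ : ℝ} (hlat : IsCuAlNiLattice α β γ) {s l : Fin 6}
    {R Q : Mat3} {lam : ℝ} {a n b m : E3} (h : IsNucleusData α β γ s R Q l lam a n b m) (P : Bar)
    (c : Fin 3 → Bool) (hm : ∀ i, 0 < inner ℝ m (P.inward c i))
    (hn : ∀ i, 0 < inner ℝ n (P.inward c i)) {δ : ℝ} (hδ : 0 < δ) {r : ℝ} (hr : 0 < r) :
    ∃ ν ∈ cornerAdmissible (variant α β γ s) P c r,
      energy α β γ δ P.region ν < energy α β γ δ P.region (pureKernel (variant α β γ s)) ∧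
      IsCornerNucleus α β γ s P.region (P.corner c) ν := by
  obtain ⟨c₁, c₂, hc₁, hc₂, hcut, hball⟩ := P.exists_cuts c hm hn hr
  have hn0 : n ≠ 0 := fun h0 => by simpa [h0] using h.sign 0
  have hm0 : m ≠ 0 := fun h0 => by simpa [h0] using h.sign 0
  have hU : energyDensity α β γ δ (variant α β γ s) = 0 := by
    simpa using energyDensity_rotated_variant (δ := δ) hlat one_mem_SO3 s
  have hV := energyDensity_rotated_variant (δ := δ) hlat h.Q_mem l
  have hR : R = variant α β γ s + (1 - lam) • tensor a n - tensor b m := by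
    rw [eq_sub_iff_add_eq, ← h.habit, h.twin]
    module
  have hopen : IsOpen {x : E3 | inner ℝ m (x - P.corner c) < c₁} :=
    isOpen_Iio.preimage (by fun_prop : Continuous fun x : E3 => inner ℝ m (x - P.corner c))
  have hmem : P.corner c ∈ {x : E3 | inner ℝ m (x - P.corner c) < c₁} := by simpa using hc₁
  refine ⟨nucleusKernel R (variant α β γ s) (Q * variant α β γ l) lam m n (P.corner c) c₁ c₂,
    isAdmissible_nucleusKernel P.isOpen_region h.lam_mem hn0 hm0 h.twin hR
      (fun x hx => hcut x (subset_closure hx)) (fun x hx => hball x (subset_closure hx))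
      h.bound h.small, ?_, ?_⟩
  · rw [energy_pureKernel _ hU]
    refine energy_nucleusKernel_neg hδ h.R_mem hU hV ((P.isOpen_region.inter hopen).measure_pos _ ?_)
    rw [inter_comm]
    exact mem_closure_iff.1 (P.corner_mem_closure c) _ hopen hmem
  · obtain ⟨ρ, hρ, hsub⟩ := Metric.isOpen_iff.1 hopen _ hmem
    refine ⟨R, h.R_mem, Q, h.Q_mem, l, lam, h.lam_mem, a, n, b, m, c₁, c₂, h.a_ne, h.b_ne, h.indep,
      hc₁, hc₂, h.twin, h.habit, ⟨ρ, hρ, fun x hx => ?_⟩, hcut, fun x _ => ?_⟩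
    · rw [nucleusKernel_apply, if_pos (by exact hsub hx.2)]
    · rw [nucleusKernel_apply]
      rfl

end CuAlNi

theorem mainTheorem2 (α β γ : ℝ) (hlat : CuAlNi.IsCuAlNiLattice α β γ) (s : Fin 6) :
    ∃ S : Finset (Fin 3 → Bool), 2 ≤ S.card ∧ ∃ ε : ℝ, 0 < ε ∧
      ∀ P : CuAlNi.Bar, P.AlignedWithin ε → ∀ c ∈ S, ∀ δ : ℝ, 0 < δ → ∀ r : ℝ, 0 < r →
        (∃ ν ∈ CuAlNi.cornerAdmissible (CuAlNi.variant α β γ s) P c r,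
          CuAlNi.energy α β γ δ P.region ν <
            CuAlNi.energy α β γ δ P.region (CuAlNi.pureKernel (CuAlNi.variant α β γ s)) ∧
          CuAlNi.IsCornerNucleus α β γ s P.region (P.corner c) ν) ∧
        ¬ CuAlNi.QuasiconvexAtCorner α β γ δ (CuAlNi.variant α β γ s) P c r := by
  classical
  obtain ⟨R, Q, l, lam, a, n, b, m, h⟩ := CuAlNi.exists_isNucleusData hlat s
  have hm : ∀ i, m i ≠ 0 := fun i => left_ne_zero_of_mul (h.sign i).ne'
  have hn : ∀ i, n i ≠ 0 := fun i => right_ne_zero_of_mul (h.sign i).ne'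
  obtain ⟨ε, hε, hεm⟩ := CuAlNi.exists_alignment_tolerance hm
  obtain ⟨ε', hε', hεn⟩ := CuAlNi.exists_alignment_tolerance hn
  -- At the first corner the `i`-th inward edge has the sign of `m i`; the second corner is
  -- diametrically opposite and takes the negated data.
  refine ⟨{fun i => decide (m i < 0), fun i => decide (0 < m i)}, ?_, min ε ε', lt_min hε hε',
    fun P hP c hc δ hδ r hr => ?_⟩
  · rw [Finset.card_pair]
    intro heq
    have := congrFun heq 0
    rcases lt_or_gt_of_ne (hm 0) with h0 | h0 <;> simp [h0, h0.not_gt] at this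
  have hPm := hεm P fun i => (hP i).trans_le (min_le_left _ _)
  have hPn := hεn P fun i => (hP i).trans_le (min_le_right _ _)
  -- Since `m i` and `n i` have equal signs, the corner selected by `m` also suits `n`.
  have hPn' : ∀ i, 0 < m i * inner ℝ n (P.frame i) := fun i => by
    have := mul_pos (h.sign i) (hPn i)
    nlinarith [sq_nonneg (n i), mul_self_pos.2 (hn i)]
  have key : ∃ ν ∈ CuAlNi.cornerAdmissible (CuAlNi.variant α β γ s) P c r,
      CuAlNi.energy α β γ δ P.region ν <
        CuAlNi.energy α β γ δ P.region (CuAlNi.pureKernel (CuAlNi.variant α β γ s)) ∧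
      CuAlNi.IsCornerNucleus α β γ s P.region (P.corner c) ν := by
    rw [Finset.mem_insert, Finset.mem_singleton] at hc
    rcases hc with rfl | rfl
    · have hin : ∀ w : CuAlNi.E3, (∀ i, 0 < m i * inner ℝ w (P.frame i)) →
          ∀ i, 0 < inner ℝ w (P.inward (fun i => decide (m i < 0)) i) := fun w hw i => by
        rw [CuAlNi.Bar.inward, real_inner_smul_right]
        rcases lt_or_gt_of_ne (hm i) with h0 | h0
        · simpa [h0] using neg_of_mul_pos_right (hw i) h0.le
        · simpa [h0.not_gt] using pos_of_mul_pos_right (hw i) h0.le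
      exact h.exists_nucleus hlat P _ (hin m hPm) (hin n hPn') hδ hr
    · have hin : ∀ w : CuAlNi.E3, (∀ i, 0 < m i * inner ℝ w (P.frame i)) →
          ∀ i, 0 < inner ℝ (-w) (P.inward (fun i => decide (0 < m i)) i) := fun w hw i => by
        rw [CuAlNi.Bar.inward, real_inner_smul_right]
        rcases lt_or_gt_of_ne (hm i) with h0 | h0
        · simpa [h0.not_gt] using neg_of_mul_pos_right (hw i) h0.le
        · simpa [h0] using pos_of_mul_pos_right (hw i) h0.le
      exact h.neg.exists_nucleus hlat P _ (hin m hPm) (hin n hPn') hδ hr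
  refine ⟨key, fun hqc => ?_⟩
  obtain ⟨ν, hν, hlt, -⟩ := key
  exact (hqc ν hν).not_gt hlt

end
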